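/- Let $G$ be an infinite group with a finite generating set $S$, and let $X$ be the Cayley graph of $G$ with respect to $S$, regarded as a geodesic metric space in which every edge has length $1$. Suppose that $X$ is $\delta$-hyperbolic, i.e. each side of every geodesic triangle in $X$ lies in the $\delta$-neighbourhood of the union of the two other sides. Let $\mathcal L$ be the language of all words with letters in $S\cup S^{-1}$ all of whose subwords (blocks of consecutive letters) of length at most $10\delta$ are geodesic in $X$. Suppose that for every pair of words $w_1,w_3\in\mathcal L$ there is a word $w_2\in\mathcal L$ such that the concatenation $w_1w_2w_3$ also belongs to $\mathcal L$. Then there exist constants $D,R$ such that for every $g\in G$ with $d_X(1_G,g)\geqslant 10\delta$ there is an element $\tilde g\in G$ with the following properties: (1) $d_X(g,\tilde g)\leqslant D$; (2) $\tilde g$ acts loxodromically on $X$, i.e. $\lim_{n\to\infty}\frac1n d_X(1_G,\tilde g^{\,n})$ exists and is positive; in particular $\tilde g$ has infinite order; (3) $\tilde g$ has an axis in $X$, i.e. a bi-infinite geodesic connecting the two points $\lim_{n\to\infty}\tilde g^{\,-n}$ and $\lim_{n\to\infty}\tilde g^{\,n}$ of the Gromov boundary $\partial X$, and every axis of $\tilde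 g$ passes within distance $R$ of the vertex $1_G$. -/

import Mathlib

open Filter Topology

noncomputable section

namespace CayleyHyp

/-! ### The geometric realization of a connected graph -/

open Classical in
/-- Barycentric coordinates of the point at distance `s` from `u` on the edge `{u, v}`. -/
def edgeCoord {V : Type*} (u v : V) (s : ℝ) : V → ℝ :=
  fun w => (1 - s) * (if w = u then 1 else 0) + s * (if w = v then 1 else 0)

/-- The geometric realization of a connected simple graph: its points are the vertices and the
points of the closed edges, given by barycentric coordinates. It carries the length metric in
which every edge has length `1` (see the instance below). -/
structure Realization {V : Type*} (Γ : SimpleGraph V) (hΓ : Γ.Connected) where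
  coord : V → ℝ
  exists_edge : ∃ u v : V, (u = v ∨ Γ.Adj u v) ∧ ∃ s ∈ Set.Icc (0 : ℝ) 1, coord = edgeCoord u v s

namespace Realization

variable {V : Type*} {Γ : SimpleGraph V} {hΓ : Γ.Connected}

theorem coord_injective {x y : Realization Γ hΓ} (h : x.coord = y.coord) : x = y := by
  cases x; cases y; cases h; rfl

/-- A vertex, as a point of the realization. -/
def vertex (u : V) : Realization Γ hΓ :=
  ⟨edgeCoord u u 0, u, u, Or.inl rfl, 0, by simp, rfl⟩

/-- `IsChain x y ℓ`: the points `x` and `y` can be joined by finitely many consecutive straight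
paths, each contained in one edge, of total length `ℓ`. -/
inductive IsChain : Realization Γ hΓ → Realization Γ hΓ → ℝ → Prop
  | nil (x : Realization Γ hΓ) : IsChain x x 0
  | cons (u v : V) (huv : Γ.Adj u v) (s t : ℝ) (hs : s ∈ Set.Icc (0 : ℝ) 1)
      (ht : t ∈ Set.Icc (0 : ℝ) 1) (x y z : Realization Γ hΓ)
      (hx : x.coord = edgeCoord u v s) (hy : y.coord = edgeCoord u v t) (ℓ : ℝ)
      (hyz : IsChain y z ℓ) : IsChain x z (|s - t| + ℓ)

theorem IsChain.trans {x y z : Realization Γ hΓ} {a b : ℝ} (h₁ : IsChain x y a)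
    (h₂ : IsChain y z b) : IsChain x z (a + b) := by
  induction h₁ with
  | nil => simpa using h₂
  | cons u v huv s t hs ht x y _ hx hy ℓ _ ih =>
    rw [add_assoc]
    exact .cons u v huv s t hs ht x y _ hx hy _ (ih h₂)

theorem IsChain.symm {x y : Realization Γ hΓ} {a : ℝ} (h : IsChain x y a) : IsChain y x a := by
  induction h with
  | nil => exact .nil _
  | cons u v huv s t hs ht x y _ hx hy ℓ _ ih =>
    have h := ih.trans (.cons u v huv t s ht hs y x x hy hx 0 (.nil x))
    rwa [add_zero, add_comm, abs_sub_comm] at h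

theorem IsChain.nonneg {x y : Realization Γ hΓ} {a : ℝ} (h : IsChain x y a) : 0 ≤ a := by
  induction h with
  | nil => exact le_rfl
  | cons u v huv s t hs ht x y _ hx hy ℓ _ ih => positivity

theorem abs_edgeCoord_sub_le {u v : V} (h : u ≠ v) (s t : ℝ) (w : V) :
    |edgeCoord u v s w - edgeCoord u v t w| ≤ |s - t| := by
  by_cases hu : w = u
  · subst hu
    rw [abs_sub_comm s t]
    refine le_of_eq (congrArg _ ?_)
    simp only [edgeCoord, if_true, if_neg h]
    ring
  · by_cases hv : w = v
    · refine le_of_eq (congrArg _ ?_)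
      simp only [edgeCoord, if_pos hv, if_neg hu]
      ring
    · simp [edgeCoord, hu, hv]

theorem IsChain.abs_coord_le {x y : Realization Γ hΓ} {a : ℝ} (h : IsChain x y a) (w : V) :
    |x.coord w - y.coord w| ≤ a := by
  induction h with
  | nil => simp
  | cons u v huv s t hs ht x y z hx hy ℓ _ ih =>
    have h₁ := abs_edgeCoord_sub_le huv.ne s t w
    rw [← hx, ← hy] at h₁
    exact (abs_sub_le _ (y.coord w) _).trans (add_le_add h₁ ih)

theorem exists_chain_vertex_vertex {u v : V} (p : Γ.Walk u v) :
    ∃ a, IsChain (vertex u : Realization Γ hΓ) (vertex v) a := by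
  induction p with
  | nil => exact ⟨0, .nil _⟩
  | @cons u v w huv _ ih =>
    obtain ⟨a, ha⟩ := ih
    refine ⟨_, .cons u v huv 0 1 (by simp) (by simp) _ (vertex v) _ ?_ ?_ a ha⟩ <;>
      · funext x; simp [vertex, edgeCoord]

theorem exists_chain_to_vertex (x : Realization Γ hΓ) : ∃ u a, IsChain x (vertex u) a := by
  obtain ⟨u, v, h, s, hs, hx⟩ := x.exists_edge
  refine ⟨u, ?_⟩
  rcases h with rfl | h
  · refine ⟨0, ?_⟩
    have : x = vertex u := coord_injective (by
      rw [hx]; funext w; simp only [vertex, edgeCoord]; ring)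
    rw [this]; exact .nil _
  · refine ⟨_, .cons u v h s 0 hs (by simp) _ (vertex u) _ hx ?_ 0 (.nil _)⟩
    funext w; simp [vertex, edgeCoord]

theorem exists_chain (x y : Realization Γ hΓ) : ∃ a, IsChain x y a := by
  obtain ⟨u, a, ha⟩ := exists_chain_to_vertex x
  obtain ⟨v, b, hb⟩ := exists_chain_to_vertex y
  obtain ⟨p⟩ := hΓ.preconnected u v
  obtain ⟨c, hc⟩ := exists_chain_vertex_vertex (hΓ := hΓ) p
  exact ⟨_, (ha.trans hc).trans hb.symm⟩

theorem bddBelow_chain (x y : Realization Γ hΓ) : BddBelow {a | IsChain x y a} :=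
  ⟨0, fun _ ha => IsChain.nonneg ha⟩

/-- The length metric: the distance is the infimum of the lengths of the paths. -/
instance : MetricSpace (Realization Γ hΓ) where
  dist x y := sInf {a | IsChain x y a}
  dist_self x := le_antisymm (csInf_le (bddBelow_chain x x) (.nil x))
    (le_csInf (exists_chain x x) fun _ ha => IsChain.nonneg ha)
  dist_comm x y := congrArg sInf (Set.ext fun _ => ⟨IsChain.symm, IsChain.symm⟩)
  dist_triangle x y z := by
    refine le_of_forall_pos_le_add fun ε hε => ?_
    obtain ⟨a, ha, ha'⟩ := exists_lt_of_csInf_lt (exists_chain x y)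
      (lt_add_of_pos_right (sInf {a | IsChain x y a}) (half_pos hε))
    obtain ⟨b, hb, hb'⟩ := exists_lt_of_csInf_lt (exists_chain y z)
      (lt_add_of_pos_right (sInf {a | IsChain y z a}) (half_pos hε))
    have := csInf_le (bddBelow_chain x z) (IsChain.trans ha hb)
    linarith
  eq_of_dist_eq_zero {x y} h := by
    refine coord_injective (funext fun w => ?_)
    have h₁ : |x.coord w - y.coord w| ≤ sInf {a | IsChain x y a} :=
      le_csInf (exists_chain x y) fun _ ha => IsChain.abs_coord_le ha w
    have h₂ : |x.coord w - y.coord w| ≤ 0 := h₁.trans (le_of_eq h)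
    exact sub_eq_zero.mp (abs_nonpos_iff.mp h₂)

end Realization

/-! ### Geodesics, hyperbolicity and loxodromic isometries -/

section Metric

variable {X : Type*} [MetricSpace X]

/-- The set `σ` is a geodesic segment with end points `x` and `y`. -/
def IsGeodesicSegment (x y : X) (σ : Set X) : Prop :=
  ∃ c : ℝ → X, c 0 = x ∧ c (dist x y) = y ∧
    (∀ s ∈ Set.Icc 0 (dist x y), ∀ t ∈ Set.Icc 0 (dist x y), dist (c s) (c t) = |s - t|) ∧
    σ = c '' Set.Icc 0 (dist x y)

variable (X) in
/-- `X` is a `δ`-hyperbolic (geodesic) space: any two points are joined by a geodesic segment, and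
each side of a geodesic triangle lies in the `δ`-neighbourhood of the two other sides. -/
def IsHyperbolic (δ : ℝ) : Prop :=
  (∀ x y : X, ∃ σ, IsGeodesicSegment x y σ) ∧
  ∀ (x y z : X) (a b c : Set X), IsGeodesicSegment x y a → IsGeodesicSegment y z b →
    IsGeodesicSegment z x c → ∀ p ∈ a, ∃ q ∈ b ∪ c, dist p q ≤ δ

/-- The Gromov product `(x | y)_p`. -/
def gromovProduct (p x y : X) : ℝ := (dist p x + dist p y - dist x y) / 2

variable {G : Type*} [Group G] [MulAction G X]

/-- The element `g` acts loxodromically: its translation length `lim d(p, gⁿ p) / n`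
exists and is positive (`p` is a base point). -/
def ActsLoxodromically (p : X) (g : G) : Prop :=
  ∃ τ : ℝ, 0 < τ ∧ Tendsto (fun n : ℕ => dist p (g ^ n • p) / n) atTop (𝓝 τ)

/-- The bi-infinite geodesic `γ` is an axis of `g`: as `t → ∞`, the points `γ t` and `γ (-t)`
converge in the Gromov boundary to the limits of `gⁿ p` and of `g⁻ⁿ p` as `n → ∞`. -/
def IsAxis (p : X) (g : G) (γ : ℝ → X) : Prop :=
  Isometry γ ∧
  Tendsto (fun q : ℝ × ℕ => gromovProduct p (γ q.1) (g ^ q.2 • p)) (atTop ×ˢ atTop) atTop ∧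
  Tendsto (fun q : ℝ × ℕ => gromovProduct p (γ (-q.1)) (g⁻¹ ^ q.2 • p)) (atTop ×ˢ atTop) atTop

end Metric

/-! ### The Cayley graph -/

section Cayley

variable {G : Type*} [Group G]

theorem cayley_connected {S : Set G} (hS : Subgroup.closure S = ⊤) :
    (SimpleGraph.mulCayley S).Connected := by
  have key : ∀ g : G, ∀ u, (SimpleGraph.mulCayley S).Reachable u (u * g) := by
    intro g
    have hg : g ∈ Subgroup.closure S := hS ▸ Subgroup.mem_top g
    induction hg using Subgroup.closure_induction with
    | mem x hx =>
      intro u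
      by_cases h : u = u * x
      · rw [← h]
      · exact ((SimpleGraph.mulCayley_adj S _ _).2 ⟨h, Or.inl (by simpa using hx)⟩).reachable
    | one => intro u; simp
    | mul x y _ _ hx hy =>
      intro u
      rw [← mul_assoc]
      exact (hx u).trans (hy (u * x))
    | inv x _ hx =>
      intro u
      simpa using (hx (u * x⁻¹)).symm
  have : Nonempty G := ⟨1⟩
  exact ⟨fun u v => by simpa using key (u⁻¹ * v) u⟩

/-- The Cayley graph of `G` with respect to the generating set `S`, as a metric space. -/
abbrev CayleySpace (S : Set G) (hS : Subgroup.closure S = ⊤) : Type _ :=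
  Realization (SimpleGraph.mulCayley S) (cayley_connected hS)

theorem edgeCoord_mul (g u v : G) (s : ℝ) (w : G) :
    edgeCoord u v s (g⁻¹ * w) = edgeCoord (g * u) (g * v) s w := by
  have h : ∀ a : G, g⁻¹ * w = a ↔ w = g * a := fun a => inv_mul_eq_iff_eq_mul
  have e : ∀ a : G, (@ite ℝ (g⁻¹ * w = a) (Classical.propDecidable _) 1 0) =
      @ite ℝ (w = g * a) (Classical.propDecidable _) 1 0 := fun a =>
    @if_congr _ _ _ (Classical.propDecidable _) (Classical.propDecidable _) _ _ _ _ (h a) rfl rfl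
  unfold edgeCoord
  rw [e u, e v]

/-- The left action of `G` on its Cayley graph; on vertices it is the left multiplication. -/
instance (S : Set G) (hS : Subgroup.closure S = ⊤) : MulAction G (CayleySpace S hS) where
  smul g x := ⟨fun w => x.coord (g⁻¹ * w), by
    obtain ⟨u, v, h, s, hs, hx⟩ := x.exists_edge
    refine ⟨g * u, g * v, ?_, s, hs, ?_⟩
    · rcases h with rfl | h
      · exact Or.inl rfl
      · exact Or.inr (SimpleGraph.mulCayley_adj_mul_iff_right.2 h)
    · funext w
      rw [hx, edgeCoord_mul]⟩
  one_smul x := Realization.coord_injective (funext fun w => by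
    change x.coord (1⁻¹ * w) = x.coord w
    simp)
  mul_smul g h x := Realization.coord_injective (funext fun w => by
    change x.coord ((g * h)⁻¹ * w) = x.coord (h⁻¹ * (g⁻¹ * w))
    simp [mul_assoc])

/-- The vertex of the Cayley graph given by the group element `g`. -/
def cayleyVertex (S : Set G) (hS : Subgroup.closure S = ⊤) (g : G) : CayleySpace S hS :=
  Realization.vertex g

/-- A word with letters in `S ∪ S⁻¹` is geodesic if the path that it labels in the Cayley graph,
which has as many edges as the word has letters, is as short as the distance of its end points. -/
def IsGeodesicWord (S : Set G) (hS : Subgroup.closure S = ⊤) (w : List G) : Prop :=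
  dist (cayleyVertex S hS 1) (cayleyVertex S hS w.prod) = w.length

/-- The language of the `k`-local geodesics: the words with letters in `S ∪ S⁻¹` in which no
non-geodesic word of length at most `k` occurs as a subword (of consecutive letters). -/
def localGeodesics (S : Set G) (hS : Subgroup.closure S = ⊤) (k : ℝ) : Language G :=
  {w | (∀ a ∈ w, a ∈ S ∨ a⁻¹ ∈ S) ∧
    ∀ v : List G, v <:+: w → (v.length : ℝ) ≤ k → IsGeodesicWord S hS v}

/-- Any two words of the language `L` can be joined by a word of `L` to form a word of `L`. -/
def ConcatenationHypothesis (L : Language G) : Prop :=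
  ∀ w₁ ∈ L, ∀ w₃ ∈ L, ∃ w₂ ∈ L, w₁ ++ w₂ ++ w₃ ∈ L

end Cayley

end CayleyHyp

end

/-! Write `n = ⌊δ⌋₊`. A point of an edge is at least as far from a given vertex as one of the two
ends of the edge, so geodesic triangles between vertices are `n`-thin in terms of vertices alone
(`vertexHyperbolic`). It follows that an `(8n+2)`-local geodesic stays within `2n` of every geodesic
with the same end points (`IsLocalGeod.exists_dist_le`).

Let `w` be a geodesic word for `g`, of length at least `K = ⌊10δ⌋₊`. The concatenation hypothesis,
applied to the last `K` and the first `K` letters of `w`, gives a word `f`. A subword of `wfw` of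
length at most `K` lies in `w` or in the word built around `f`, so it is geodesic. Hence the line
through `1` labelled by the powers of `wf` is a local geodesic, shifted by `g' = wf`
(`isPeriodicGeod_wordLine`). Since `f` depends only on two words of length `K`, its length is
bounded; this bounds `d(g, g')`.

The rest follows from the existence of such a line (`IsPeriodicGeod`). The line cannot return to
`1`, so `g'` has infinite order. Geodesics from `g'⁻ᵐ` to `g'ᵐ` pass within `2n` of all intermediate
powers; by local finiteness they have a bi-infinite limit, along which the powers of `g'` advance
linearly (`exists_geodesic_linear`). This yields both the positive translation length and an axis.
Any other axis forms a thin quadrilateral with a long geodesic from `g'⁻ᵐ` to `g'ᵐ`, so it passes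
within `R = 2n + 2δ` of `1`.

The inequality `8n + 2 ≤ 10δ` needed here holds for `δ ≥ 1/5`. For smaller `δ` the graph has no
triangles, reduced words of length at most `2` are geodesic, and an `f` with at most one letter is
found by hand (`hasContinuations_of_lt_half`). -/

noncomputable section

namespace CayleyHyp

/-! ### Paths and geodesics in the realization, and hyperbolicity in terms of vertices -/

namespace Realization

variable {V : Type*} {Γ : SimpleGraph V} {hΓ : Γ.Connected}

/-- The affine extension to the realization of a function on the vertices. -/
def interp (f : V → ℝ) (x : Realization Γ hΓ) : ℝ := ∑ᶠ w, x.coord w * f w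

/-- Defining `interp` through the coordinates makes it independent of the edge used to describe the
point; the sum has support in `{u, v}`. -/
theorem interp_of_coord (f : V → ℝ) {x : Realization Γ hΓ} {u v : V} {s : ℝ}
    (hx : x.coord = edgeCoord u v s) : interp f x = (1 - s) * f u + s * f v := by
  classical
  have h₁ : ∀ (a : V) (r : ℝ), ∑ᶠ w, r * (if w = a then 1 else 0) * f w = r * f a := by
    intro a r
    rw [finsum_eq_single _ a]
    · simp
    · intro w hw
      simp [hw]
  have h₂ : ∀ (a : V) (r : ℝ),
      (Function.support fun w => r * (if w = a then (1 : ℝ) else 0) * f w).Finite := by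
    intro a r
    refine (Set.finite_singleton a).subset fun w hw => ?_
    by_contra h
    have h' : w ≠ a := h
    simp [h'] at hw
  rw [← h₁ u, ← h₁ v, ← finsum_add_distrib (h₂ _ _) (h₂ _ _), interp, hx]
  refine finsum_congr fun w => ?_
  simp only [edgeCoord]
  rw [add_mul]

/-- The source of all lower bounds on distances between vertices and along paths: `f` is taken to be
the graph distance from a fixed vertex. -/
theorem abs_interp_sub_le {f : V → ℝ} (hf : ∀ u v, Γ.Adj u v → |f u - f v| ≤ 1)
    (x y : Realization Γ hΓ) : |interp f x - interp f y| ≤ dist x y := by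
  refine le_csInf (exists_chain x y) fun a ha => ?_
  induction ha with
  | nil => simp
  | cons u v huv s t hs ht x y z hx hy ℓ _ ih =>
    refine (abs_sub_le _ (interp f y) _).trans (add_le_add ?_ ih)
    rw [interp_of_coord f hx, interp_of_coord f hy]
    have : (1 - s) * f u + s * f v - ((1 - t) * f u + t * f v) = (t - s) * (f u - f v) := by ring
    rw [this, abs_mul, abs_sub_comm t s]
    exact mul_le_of_le_one_right (abs_nonneg _) (hf u v huv)

theorem abs_coord_sub_le (x y : Realization Γ hΓ) (w : V) :
    |x.coord w - y.coord w| ≤ dist x y :=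
  le_csInf (exists_chain x y) fun _ ha => IsChain.abs_coord_le ha w

theorem edgeCoord_self (u : V) (s : ℝ) : edgeCoord u u s = edgeCoord u u 0 := by
  funext w
  simp only [edgeCoord]
  ring

theorem edgeCoord_zero (u v : V) : edgeCoord u v 0 = edgeCoord u u 0 := by
  funext w
  simp [edgeCoord]

theorem edgeCoord_one (u v : V) : edgeCoord u v 1 = edgeCoord v v 0 := by
  funext w
  simp [edgeCoord]

theorem dist_le_of_coord {x y : Realization Γ hΓ} {u v : V} (h : u = v ∨ Γ.Adj u v) {s t : ℝ}
    (hs : s ∈ Set.Icc (0 : ℝ) 1) (ht : t ∈ Set.Icc (0 : ℝ) 1) (hx : x.coord = edgeCoord u v s)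
    (hy : y.coord = edgeCoord u v t) : dist x y ≤ |s - t| := by
  rcases h with rfl | h
  · have : x = y := coord_injective (by rw [hx, hy, edgeCoord_self, edgeCoord_self u t])
    rw [this, dist_self]
    exact abs_nonneg _
  · have := IsChain.cons u v h s t hs ht x y y hx hy 0 (.nil y)
    rw [add_zero] at this
    exact csInf_le (bddBelow_chain x y) this

theorem abs_graphDist_sub_le (hΓ : Γ.Connected) (a u v : V) :
    |(Γ.dist a u : ℝ) - Γ.dist a v| ≤ Γ.dist u v := by
  have h₁ : (Γ.dist a u : ℝ) ≤ Γ.dist a v + Γ.dist v u := mod_cast hΓ.dist_triangle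
  have h₂ : (Γ.dist a v : ℝ) ≤ Γ.dist a u + Γ.dist u v := mod_cast hΓ.dist_triangle
  rw [SimpleGraph.dist_comm (u := v)] at h₁
  rw [abs_le]
  constructor <;> linarith

theorem abs_graphDist_sub_le_one (hΓ : Γ.Connected) (a u v : V) (h : Γ.Adj u v) :
    |(Γ.dist a u : ℝ) - Γ.dist a v| ≤ 1 :=
  (abs_graphDist_sub_le hΓ a u v).trans (by rw [SimpleGraph.dist_eq_one_iff_adj.2 h]; simp)

theorem interp_vertex (f : V → ℝ) (u : V) : interp f (vertex u : Realization Γ hΓ) = f u := by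
  rw [interp_of_coord (u := u) (v := u) (s := 0) f rfl]
  ring

theorem dist_vertex (u v : V) :
    dist (vertex u : Realization Γ hΓ) (vertex v) = Γ.dist u v := by
  refine le_antisymm ?_ ?_
  · obtain ⟨p, hp⟩ := hΓ.exists_walk_length_eq_dist u v
    rw [← hp]
    clear hp
    induction p with
    | nil => simp
    | @cons u v w huv p ih =>
      refine (dist_triangle _ (vertex v) _).trans ?_
      have := dist_le_of_coord (x := (vertex u : Realization Γ hΓ)) (y := vertex v) (s := 0)
        (t := 1) (Or.inr huv) (by simp) (by simp) (edgeCoord_zero u v).symm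
        (edgeCoord_one u v).symm
      rw [zero_sub, abs_neg, abs_one] at this
      rw [SimpleGraph.Walk.length_cons]
      push_cast
      linarith
  · have := abs_interp_sub_le (abs_graphDist_sub_le_one hΓ u) (vertex u : Realization Γ hΓ)
      (vertex v)
    rw [interp_vertex, interp_vertex, SimpleGraph.dist_self] at this
    simpa using this

/-- The path in the realization through the consecutive vertices `p i`, parametrized so that it
is at `p i` at time `i`. -/
def path (p : ℤ → V) (hp : ∀ i, p i = p (i + 1) ∨ Γ.Adj (p i) (p (i + 1))) (t : ℝ) :
    Realization Γ hΓ :=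
  ⟨edgeCoord (p ⌊t⌋) (p (⌊t⌋ + 1)) (Int.fract t), p ⌊t⌋, p (⌊t⌋ + 1), hp _, Int.fract t,
    ⟨Int.fract_nonneg t, (Int.fract_lt_one t).le⟩, rfl⟩

variable {p : ℤ → V} (hp : ∀ i, p i = p (i + 1) ∨ Γ.Adj (p i) (p (i + 1)))

theorem path_intCast (i : ℤ) : path (hΓ := hΓ) p hp i = vertex (p i) := by
  refine coord_injective ?_
  simp only [path, Int.floor_intCast, Int.fract_intCast, edgeCoord_zero]
  rfl

theorem path_coord_of_mem {i : ℤ} {t : ℝ} (h₁ : (i : ℝ) ≤ t) (h₂ : t ≤ i + 1) :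
    (path (hΓ := hΓ) p hp t).coord = edgeCoord (p i) (p (i + 1)) (t - i) := by
  rcases h₂.lt_or_eq with h₂ | h₂
  · have : ⌊t⌋ = i := Int.floor_eq_iff.2 ⟨h₁, h₂⟩
    simp only [path, Int.fract, this]
  · have : t = ((i + 1 : ℤ) : ℝ) := by rw [h₂]; push_cast; ring
    rw [this, path_intCast]
    push_cast
    rw [add_sub_cancel_left, edgeCoord_one]
    rfl

theorem dist_path_le_of_mem {i : ℤ} {s t : ℝ} (hs₁ : (i : ℝ) ≤ s) (hs₂ : s ≤ i + 1)
    (ht₁ : (i : ℝ) ≤ t) (ht₂ : t ≤ i + 1) :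
    dist (path (hΓ := hΓ) p hp s) (path p hp t) ≤ |s - t| := by
  have := dist_le_of_coord (hp i) (s := s - i) (t := t - i) ⟨by linarith, by linarith⟩
    ⟨by linarith, by linarith⟩ (path_coord_of_mem (hΓ := hΓ) hp hs₁ hs₂)
    (path_coord_of_mem (hΓ := hΓ) hp ht₁ ht₂)
  simpa using this

theorem dist_path_add_natCast_le (i : ℤ) (n : ℕ) :
    dist (path (hΓ := hΓ) p hp i) (path p hp ((i + n : ℤ) : ℝ)) ≤ n := by
  induction n with
  | zero => simp
  | succ n ih =>
    refine (dist_triangle _ (path p hp ((i + n : ℤ) : ℝ)) _).trans ?_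
    have := dist_path_le_of_mem (hΓ := hΓ) hp (i := i + n) (s := ((i + n : ℤ) : ℝ))
      (t := ((i + (n + 1 : ℕ) : ℤ) : ℝ)) le_rfl (by linarith) (by push_cast; linarith)
      (by push_cast; linarith)
    have h : |((i + n : ℤ) : ℝ) - ((i + (n + 1 : ℕ) : ℤ) : ℝ)| = 1 := by
      push_cast
      rw [show (i + n : ℝ) - (i + (n + 1)) = -1 by ring, abs_neg, abs_one]
    rw [h] at this
    push_cast at *
    linarith

theorem dist_path_le_of_le {s t : ℝ} (hst : s ≤ t) :
    dist (path (hΓ := hΓ) p hp s) (path p hp t) ≤ t - s := by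
  rcases (Int.floor_le_floor hst).eq_or_lt with h | h
  · have := dist_path_le_of_mem (hΓ := hΓ) hp (i := ⌊s⌋) (s := s) (t := t) (Int.floor_le s)
      (Int.lt_floor_add_one s).le (h ▸ Int.floor_le t) (h ▸ (Int.lt_floor_add_one t).le)
    rwa [abs_sub_comm, abs_of_nonneg (by linarith)] at this
  · obtain ⟨n, hn⟩ := Int.le.dest (Int.add_one_le_of_lt h)
    have h₁ := dist_path_le_of_mem (hΓ := hΓ) hp (i := ⌊s⌋) (s := s) (t := ((⌊s⌋ + 1 : ℤ) : ℝ))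
      (Int.floor_le s) (Int.lt_floor_add_one s).le (by push_cast; linarith)
      (by push_cast; linarith)
    have h₂ := dist_path_add_natCast_le (hΓ := hΓ) hp (⌊s⌋ + 1) n
    have h₃ := dist_path_le_of_mem (hΓ := hΓ) hp (i := ⌊t⌋) (s := (⌊t⌋ : ℝ)) (t := t)
      le_rfl (by linarith) (Int.floor_le t) (Int.lt_floor_add_one t).le
    rw [hn] at h₂
    have hn' : (⌊s⌋ : ℝ) + 1 + n = ⌊t⌋ := mod_cast hn
    rw [abs_sub_comm, abs_of_nonneg (by push_cast; linarith [Int.lt_floor_add_one s])] at h₁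
    rw [abs_sub_comm, abs_of_nonneg (by linarith [Int.floor_le t])] at h₃
    push_cast at h₁
    have h₄ := dist_triangle4 (path (hΓ := hΓ) p hp s) (path p hp ((⌊s⌋ + 1 : ℤ) : ℝ))
      (path p hp ⌊t⌋) (path p hp t)
    push_cast at *
    linarith

/-- The sequence of vertices `p` is geodesic between the times `a` and `b`. -/
def IsGeod (Γ : SimpleGraph V) (p : ℤ → V) (a b : ℤ) : Prop :=
  ∀ i j, a ≤ i → i ≤ j → j ≤ b → (Γ.dist (p i) (p j) : ℤ) = j - i

theorem interp_path {f : V → ℝ} {i : ℤ} {t : ℝ} (h₁ : (i : ℝ) ≤ t) (h₂ : t ≤ i + 1) :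
    interp f (path (hΓ := hΓ) p hp t) =
      (1 - (t - i)) * f (p i) + (t - i) * f (p (i + 1)) :=
  interp_of_coord f (path_coord_of_mem hp h₁ h₂)

theorem IsGeod.dist_path {a b : ℤ} (hg : IsGeod Γ p a b) {s t : ℝ} (has : a ≤ s) (hst : s ≤ t)
    (htb : t ≤ b) : dist (path (hΓ := hΓ) p hp s) (path p hp t) = t - s := by
  refine le_antisymm (dist_path_le_of_le hp hst) ?_
  -- The lower bound: the interpolated distance from `p a` equals `r - a` along the path and is
  -- `1`-Lipschitz.
  set f : V → ℝ := fun v => Γ.dist (p a) v with hf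
  have key : ∀ r : ℝ, a ≤ r → r ≤ b → interp f (path (hΓ := hΓ) p hp r) = r - a := by
    intro r h₁ h₂
    have hfi : ∀ i : ℤ, a ≤ i → i ≤ b → f (p i) = i - a := fun i hi hi' => by
      have := hg a i le_rfl hi hi'
      change (Γ.dist (p a) (p i) : ℝ) = i - a
      exact mod_cast this
    have hfl : a ≤ ⌊r⌋ := Int.le_floor.2 h₁
    rcases (Int.floor_le_iff.2 (h₂.trans_lt (lt_add_one _)) : ⌊r⌋ ≤ b).eq_or_lt with h | h
    · have hr : r = b := le_antisymm h₂ (h ▸ Int.floor_le r)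
      rw [hr, path_intCast, interp_vertex, hfi b (h ▸ hfl) le_rfl]
    · rw [interp_path hp (Int.floor_le r) (Int.lt_floor_add_one r).le, hfi _ hfl h.le,
        hfi _ (by omega) h]
      push_cast
      ring
  have := abs_interp_sub_le (abs_graphDist_sub_le_one hΓ (p a)) (path (hΓ := hΓ) p hp t)
    (path p hp s)
  rw [key t (has.trans hst) htb, key s has (hst.trans htb), dist_comm] at this
  linarith [le_abs_self (t - ↑a - (s - ↑a))]

/-- The sequence that agrees with `p` on `[a, b]` and is constant on either side. -/
def clamp (p : ℤ → V) (a b : ℤ) (i : ℤ) : V := p (max a (min b i))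

theorem clamp_of_mem {a b i : ℤ} (h₁ : a ≤ i) (h₂ : i ≤ b) : clamp p a b i = p i := by
  rw [clamp, min_eq_right h₂, max_eq_right h₁]

theorem IsGeod.adj {a b i : ℤ} (hg : IsGeod Γ p a b) (h₁ : a ≤ i) (h₂ : i + 1 ≤ b) :
    Γ.Adj (p i) (p (i + 1)) := by
  have := hg i (i + 1) h₁ (by omega) h₂
  exact SimpleGraph.dist_eq_one_iff_adj.1 (by omega)

/-- `path` requires every step to be an edge or constant, while `IsGeod` says nothing outside `[a,
b]`; clamping fills this gap. -/
theorem IsGeod.clamp_step {a b : ℤ} (hg : IsGeod Γ p a b) (i : ℤ) :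
    clamp p a b i = clamp p a b (i + 1) ∨ Γ.Adj (clamp p a b i) (clamp p a b (i + 1)) := by
  by_cases h : a ≤ i ∧ i + 1 ≤ b
  · right
    rw [clamp_of_mem h.1 (by omega), clamp_of_mem (by omega) h.2]
    exact hg.adj h.1 h.2
  · left
    unfold clamp
    congr 1
    omega

theorem IsGeod.clamp {a b : ℤ} (hg : IsGeod Γ p a b) : IsGeod Γ (clamp p a b) a b := by
  intro i j h₁ h₂ h₃
  rw [clamp_of_mem h₁ (by omega), clamp_of_mem (by omega) h₃]
  exact hg i j h₁ h₂ h₃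

/-- The geodesic segment through the vertices of a geodesic sequence. -/
def IsGeod.segment {a b : ℤ} (hg : IsGeod Γ p a b) : Set (Realization Γ hΓ) :=
  path (Realization.clamp p a b) hg.clamp_step '' Set.Icc (a : ℝ) b

theorem IsGeod.isGeodesicSegment {a b : ℤ} (hg : IsGeod Γ p a b) (hab : a ≤ b) :
    IsGeodesicSegment (vertex (p a) : Realization Γ hΓ) (vertex (p b)) hg.segment := by
  have hab' : (a : ℝ) ≤ b := mod_cast hab
  have hd : dist (vertex (p a) : Realization Γ hΓ) (vertex (p b)) = b - a := by
    rw [dist_vertex]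
    exact mod_cast hg a b le_rfl hab le_rfl
  refine ⟨fun t => path (Realization.clamp p a b) hg.clamp_step (t + a), ?_, ?_, ?_, ?_⟩
  · simp only [zero_add]
    rw [path_intCast, clamp_of_mem le_rfl hab]
  · simp only [hd, sub_add_cancel]
    rw [path_intCast, clamp_of_mem hab le_rfl]
  · rw [hd]
    intro s hs t ht
    rcases le_total s t with h | h
    · rw [hg.clamp.dist_path _ (by linarith [hs.1]) (by linarith) (by linarith [ht.2]),
        abs_sub_comm, abs_of_nonneg (by linarith)]
      ring
    · rw [dist_comm, hg.clamp.dist_path _ (by linarith [ht.1]) (by linarith) (by linarith [hs.2]),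
        abs_of_nonneg (by linarith)]
      ring
  · rw [hd, IsGeod.segment]
    ext x
    constructor
    · rintro ⟨t, ht, rfl⟩
      exact ⟨t - a, ⟨by linarith [ht.1], by linarith [ht.2]⟩, by simp⟩
    · rintro ⟨t, ht, rfl⟩
      exact ⟨t + a, ⟨by linarith [ht.1], by linarith [ht.2]⟩, rfl⟩

theorem IsGeod.vertex_mem_segment {a b i : ℤ} (hg : IsGeod Γ p a b) (h₁ : a ≤ i) (h₂ : i ≤ b) :
    (vertex (p i) : Realization Γ hΓ) ∈ (hg.segment : Set (Realization Γ hΓ)) :=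
  ⟨i, ⟨mod_cast h₁, mod_cast h₂⟩, by rw [path_intCast, clamp_of_mem h₁ h₂]⟩

/-- Among the points of the segment of a geodesic sequence, a vertex is closest to a given
vertex. -/
theorem IsGeod.exists_dist_le {a b : ℤ} (hg : IsGeod Γ p a b) (hab : a ≤ b) (v : V)
    {q : Realization Γ hΓ} (hq : q ∈ (hg.segment : Set (Realization Γ hΓ))) :
    ∃ i, a ≤ i ∧ i ≤ b ∧ (Γ.dist v (p i) : ℝ) ≤ dist (vertex v) q := by
  obtain ⟨t, ht, rfl⟩ := hq
  set f : V → ℝ := fun w => Γ.dist v w with hf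
  have h := abs_interp_sub_le (abs_graphDist_sub_le_one hΓ v)
    (path (hΓ := hΓ) (Realization.clamp p a b) hg.clamp_step t) (vertex v)
  rw [interp_vertex, SimpleGraph.dist_self, Nat.cast_zero, sub_zero, dist_comm] at h
  have h := (le_abs_self _).trans h
  have h₁ := Int.floor_le t
  have h₂ := Int.lt_floor_add_one t
  rw [interp_path _ h₁ h₂.le] at h
  -- The interpolated value is a convex combination of the values at the two ends, hence at least
  -- the smaller of them.
  by_cases hle : f (Realization.clamp p a b ⌊t⌋) ≤ f (Realization.clamp p a b (⌊t⌋ + 1))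
  · refine ⟨max a (min b ⌊t⌋), le_max_left _ _, by omega, le_trans ?_ h⟩
    change f (Realization.clamp p a b ⌊t⌋) ≤ _
    nlinarith
  · refine ⟨max a (min b (⌊t⌋ + 1)), le_max_left _ _, by omega, le_trans ?_ h⟩
    change f (Realization.clamp p a b (⌊t⌋ + 1)) ≤ _
    nlinarith

/-- Unit steps bound every partial distance from above; if the end points are far enough apart, the
triangle inequality leaves no slack anywhere. -/
theorem isGeod_of_step {a b : ℤ} (hΓ : Γ.Connected)
    (hstep : ∀ i, a ≤ i → i < b → Γ.dist (p i) (p (i + 1)) ≤ 1)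
    (hend : (b - a : ℤ) ≤ Γ.dist (p a) (p b)) : IsGeod Γ p a b := by
  have key : ∀ n : ℕ, ∀ i, a ≤ i → i + n ≤ b → Γ.dist (p i) (p (i + n)) ≤ n := by
    intro n i hi
    induction n with
    | zero => simp
    | succ n ih =>
      intro h
      push_cast at h ⊢
      have h₁ := ih (by omega)
      have h₂ := hstep (i + n) (by omega) (by omega)
      have h₃ : Γ.dist (p i) (p (i + (n + 1))) ≤ Γ.dist (p i) (p (i + n)) +
        Γ.dist (p (i + n)) (p (i + (n + 1))) := hΓ.dist_triangle
      rw [add_assoc] at h₂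
      omega
  have key' : ∀ i j, a ≤ i → i ≤ j → j ≤ b → (Γ.dist (p i) (p j) : ℤ) ≤ j - i := by
    intro i j h₁ h₂ h₃
    have := key (j - i).toNat i h₁ (by omega)
    rw [Int.toNat_of_nonneg (by omega), add_sub_cancel] at this
    omega
  intro i j h₁ h₂ h₃
  have e₁ := key' a i le_rfl h₁ (by omega)
  have e₂ := key' i j h₁ h₂ h₃
  have e₃ := key' j b (by omega) h₃ le_rfl
  have t₁ : Γ.dist (p a) (p b) ≤ Γ.dist (p a) (p i) + Γ.dist (p i) (p b) := hΓ.dist_triangle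
  have t₂ : Γ.dist (p i) (p b) ≤ Γ.dist (p i) (p j) + Γ.dist (p j) (p b) := hΓ.dist_triangle
  omega

/-- The vertex `v` lies on some geodesic from `x` to `y`. -/
def Between (Γ : SimpleGraph V) (x v y : V) : Prop := Γ.dist x v + Γ.dist v y = Γ.dist x y

theorem Between.symm {x v y : V} (h : Between Γ x v y) : Between Γ y v x := by
  unfold Between at *
  rw [SimpleGraph.dist_comm (u := y) (v := v), SimpleGraph.dist_comm (u := v) (v := x),
    SimpleGraph.dist_comm (u := y) (v := x)]
  omega

theorem IsGeod.between {a b i : ℤ} (hg : IsGeod Γ p a b) (h₁ : a ≤ i) (h₂ : i ≤ b) :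
    Between Γ (p a) (p i) (p b) := by
  have e₁ := hg a i le_rfl h₁ h₂
  have e₂ := hg i b h₁ h₂ le_rfl
  have e₃ := hg a b le_rfl (h₁.trans h₂) le_rfl
  unfold Between
  omega

theorem Between.exists_isGeod (hΓ : Γ.Connected) {x v y : V} (h : Between Γ x v y) :
    ∃ p : ℤ → V, IsGeod Γ p 0 (Γ.dist x y) ∧ p 0 = x ∧ p (Γ.dist x v) = v ∧
      p (Γ.dist x y) = y := by
  obtain ⟨w₁, hw₁⟩ := hΓ.exists_walk_length_eq_dist x v
  obtain ⟨w₂, hw₂⟩ := hΓ.exists_walk_length_eq_dist v y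
  set w := w₁.append w₂ with hw
  have hl : w.length = Γ.dist x y := by
    rw [hw, SimpleGraph.Walk.length_append, hw₁, hw₂]
    exact h
  have hy : w.getVert (Γ.dist x y) = y := by rw [← hl, w.getVert_length]
  refine ⟨fun i => w.getVert i.toNat, isGeod_of_step hΓ ?_ ?_, ?_, ?_, ?_⟩
  · intro i h₁ h₂
    have := w.adj_getVert_succ (i := i.toNat) (by omega)
    rw [show (i + 1).toNat = i.toNat + 1 by omega]
    exact (SimpleGraph.dist_eq_one_iff_adj.2 this).le
  · simp [hy]
  · simp
  · simp only [Int.toNat_natCast]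
    rw [hw, SimpleGraph.Walk.getVert_append, ← hw₁]
    simp
  · simp [hy]

theorem exists_isGeod (hΓ : Γ.Connected) (x y : V) :
    ∃ p : ℤ → V, IsGeod Γ p 0 (Γ.dist x y) ∧ p 0 = x ∧ p (Γ.dist x y) = y := by
  have : Between Γ x x y := by simp [Between]
  obtain ⟨p, h₁, h₂, -, h₃⟩ := this.exists_isGeod hΓ
  exact ⟨p, h₁, h₂, h₃⟩

/-- Hyperbolicity in terms of vertices: a vertex on a side of a geodesic triangle is at distance
at most `n` from a vertex of the other sides. -/
def VertexHyperbolic (Γ : SimpleGraph V) (n : ℕ) : Prop :=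
  ∀ (x v y : V), Between Γ x v y → ∀ (p : ℤ → V) (a b : ℤ), a ≤ b → IsGeod Γ p a b → p a = y →
    (∃ i, a ≤ i ∧ i ≤ b ∧ Γ.dist v (p i) ≤ n) ∨ ∃ q, Between Γ (p b) q x ∧ Γ.dist v q ≤ n

/-- A nearby point of a side can be replaced by a vertex of that side without increasing the
distance, and integer distances at most `δ` are at most `⌊δ⌋₊`. One side remains a prescribed
sequence because closeness to a given geodesic is wanted later; for the other sides lying on some
geodesic suffices. -/
theorem vertexHyperbolic {δ : ℝ} (hδ : IsHyperbolic (Realization Γ hΓ) δ) :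
    VertexHyperbolic Γ ⌊δ⌋₊ := by
  intro x v y hv p a b hab hp hy
  obtain ⟨c, hc, hcx, hcv, hcy⟩ := hv.exists_isGeod hΓ
  obtain ⟨e, he, hez, hex⟩ := exists_isGeod hΓ (p b) x
  have s₁ := hc.isGeodesicSegment (hΓ := hΓ) (by omega)
  have s₂ := hp.isGeodesicSegment (hΓ := hΓ) hab
  have s₃ := he.isGeodesicSegment (hΓ := hΓ) (by omega)
  rw [hcx, hcy] at s₁
  rw [hy] at s₂
  rw [hez, hex] at s₃
  have hm := hc.vertex_mem_segment (hΓ := hΓ) (i := Γ.dist x v) (by omega)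
    (by unfold Between at hv; omega)
  rw [hcv] at hm
  obtain ⟨q, hq, hd⟩ := hδ.2 _ _ _ _ _ _ s₁ s₂ s₃ _ hm
  rcases hq with hq | hq
  · obtain ⟨i, h₁, h₂, h₃⟩ := hp.exists_dist_le hab v hq
    exact Or.inl ⟨i, h₁, h₂, Nat.le_floor (h₃.trans hd)⟩
  · obtain ⟨i, h₁, h₂, h₃⟩ := he.exists_dist_le (by omega) v hq
    refine Or.inr ⟨e i, ?_, Nat.le_floor (h₃.trans hd)⟩
    have := he.between h₁ h₂
    rwa [hez, hex] at this

end Realization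

/-! ### Thin polygons and stability of local geodesics -/

namespace Realization

variable {V : Type*} {Γ : SimpleGraph V} {n : ℕ}

theorem IsGeod.mono {p : ℤ → V} {a b a' b' : ℤ} (hg : IsGeod Γ p a b) (ha : a ≤ a')
    (hb : b' ≤ b) : IsGeod Γ p a' b' :=
  fun i j h₁ h₂ h₃ => hg i j (ha.trans h₁) h₂ (h₃.trans hb)

theorem IsGeod.reverse {p : ℤ → V} {a b : ℤ} (hg : IsGeod Γ p a b) :
    IsGeod Γ (fun i => p (-i)) (-b) (-a) := by
  intro i j h₁ h₂ h₃
  rw [SimpleGraph.dist_comm, hg (-j) (-i) (by omega) (by omega) (by omega)]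
  ring

theorem IsGeod.shift {p : ℤ → V} {a b : ℤ} (hg : IsGeod Γ p a b) (k : ℤ) :
    IsGeod Γ (fun i => p (k + i)) (a - k) (b - k) := by
  intro i j h₁ h₂ h₃
  rw [hg (k + i) (k + j) (by omega) (by omega) (by omega)]
  ring

/-- Thin triangles one of whose sides is a subsegment of a given geodesic, in either direction. -/
theorem VertexHyperbolic.triangle (hn : VertexHyperbolic Γ n) {p : ℤ → V} {a b j k : ℤ}
    (hp : IsGeod Γ p a b) (hj : a ≤ j ∧ j ≤ b) (hk : a ≤ k ∧ k ≤ b) {x v : V}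
    (hv : Between Γ x v (p j)) :
    (∃ i, a ≤ i ∧ i ≤ b ∧ Γ.dist v (p i) ≤ n) ∨ ∃ q, Between Γ (p k) q x ∧ Γ.dist v q ≤ n := by
  rcases le_total j k with h | h
  · rcases hn x v _ hv p j k h (hp.mono hj.1 hk.2) rfl with ⟨i, h₁, h₂, h₃⟩ | hq
    · exact Or.inl ⟨i, by omega, by omega, h₃⟩
    · exact Or.inr hq
  · rcases hn x v _ hv (fun i => p (-i)) (-j) (-k) (by omega)
      (hp.mono hk.1 hj.2).reverse (by simp) with ⟨i, h₁, h₂, h₃⟩ | hq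
    · exact Or.inl ⟨-i, by omega, by omega, h₃⟩
    · rw [neg_neg] at hq
      exact Or.inr hq

/-- Thin quadrilaterals one of whose sides is a subsegment of a given geodesic. -/
theorem VertexHyperbolic.quadrilateral (hΓ : Γ.Connected) (hn : VertexHyperbolic Γ n)
    {p : ℤ → V} {a b j k : ℤ} (hp : IsGeod Γ p a b) (hj : a ≤ j ∧ j ≤ b) (hk : a ≤ k ∧ k ≤ b)
    {x y z : V} (hx : Between Γ y x z) :
    (∃ i, a ≤ i ∧ i ≤ b ∧ Γ.dist x (p i) ≤ 2 * n) ∨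
      (∃ w, Between Γ y w (p j) ∧ Γ.dist x w ≤ 2 * n) ∨
      ∃ w, Between Γ z w (p k) ∧ Γ.dist x w ≤ 2 * n := by
  obtain ⟨e, he, hez, hek⟩ := exists_isGeod hΓ z (p k)
  rcases hn y x z hx e 0 _ (by omega) he hez with ⟨i, h₁, h₂, h₃⟩ | ⟨q, hq, hxq⟩
  · refine Or.inr (Or.inr ⟨e i, ?_, by omega⟩)
    have := he.between h₁ h₂
    rwa [hez, hek] at this
  · rw [hek] at hq
    rcases hn.triangle hp hk hj hq.symm with ⟨i, h₁, h₂, h₃⟩ | ⟨w, hw, hqw⟩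
    · have : Γ.dist x (p i) ≤ Γ.dist x q + Γ.dist q (p i) := hΓ.dist_triangle
      exact Or.inl ⟨i, h₁, h₂, by omega⟩
    · have : Γ.dist x w ≤ Γ.dist x q + Γ.dist q w := hΓ.dist_triangle
      exact Or.inr (Or.inl ⟨w, hw.symm, by omega⟩)

/-- The sequence `c` of vertices is an `N`-local geodesic. -/
def IsLocalGeod (Γ : SimpleGraph V) (c : ℤ → V) (N : ℕ) : Prop :=
  ∀ i j : ℤ, i ≤ j → j ≤ i + N → (Γ.dist (c i) (c j) : ℤ) = j - i

/-- Local geodesics stay close to the geodesics with the same end points. -/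
theorem IsLocalGeod.exists_dist_le (hΓ : Γ.Connected) (hn : VertexHyperbolic Γ n) {c : ℤ → V}
    (hc : IsLocalGeod Γ c (8 * n + 2)) {p : ℤ → V} {a' b' : ℤ} (hp : IsGeod Γ p a' b')
    (hab' : a' ≤ b') {a b : ℤ} (ha : p a' = c a) (hb : p b' = c b) {i : ℤ} (hai : a ≤ i)
    (hib : i ≤ b) : ∃ k, a' ≤ k ∧ k ≤ b' ∧ Γ.dist (c i) (p k) ≤ 2 * n := by
  have hmin : ∀ i, ∃ k, (a' ≤ k ∧ k ≤ b') ∧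
      ∀ k', a' ≤ k' → k' ≤ b' → Γ.dist (c i) (p k) ≤ Γ.dist (c i) (p k') := by
    intro i
    obtain ⟨k, hk, hk'⟩ := Finset.exists_min_image (Finset.Icc a' b')
      (fun k => Γ.dist (c i) (p k)) ⟨a', by simpa using hab'⟩
    exact ⟨k, by simpa using hk, fun k' h₁ h₂ => hk' k' (by simp [h₁, h₂])⟩
  choose π hπ hπmin using hmin
  -- `c m` is a point of the local geodesic farthest from `p`; it suffices to bound its distance.
  obtain ⟨m, hm, hmax⟩ := Finset.exists_max_image (Finset.Icc a b)
    (fun i => Γ.dist (c i) (p (π i))) ⟨i, by simp [hai, hib]⟩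
  simp only [Finset.mem_Icc] at hm hmax
  suffices h : Γ.dist (c m) (p (π m)) ≤ 2 * n from
    ⟨π i, (hπ i).1, (hπ i).2, (hmax i ⟨hai, hib⟩).trans h⟩
  by_contra! hlt
  have h₀ : Γ.dist (c a) (p (π a)) = 0 := by
    have := hπmin a a' le_rfl hab'
    rw [ha, SimpleGraph.dist_self] at this
    omega
  have h₁ : Γ.dist (c b) (p (π b)) = 0 := by
    have := hπmin b b' hab' le_rfl
    rw [hb, SimpleGraph.dist_self] at this
    omega
  -- A lateral side of the quadrilateral stays away from `c m`: otherwise `w` is more than `2n` from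
  -- `c y`, so going from `c m` through `w` reaches `p` in fewer than `d(c y, p)` steps, against
  -- maximality at `m`. If that side is a single point, `c m` itself would be within `2n` of `p`.
  have key : ∀ y w, a ≤ y → y ≤ b →
      (Γ.dist (c y) (p (π y)) = 0 ∨ Γ.dist (c y) (c m) = 4 * n + 1) →
      Between Γ (c y) w (p (π y)) → ¬ Γ.dist (c m) w ≤ 2 * n := by
    intro y w hay hyb hy hw hmw
    have t₁ := hπmin m (π y) (hπ y).1 (hπ y).2
    have t₂ : Γ.dist (c m) (p (π y)) ≤ Γ.dist (c m) w + Γ.dist w (p (π y)) := hΓ.dist_triangle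
    have t₃ : Γ.dist (c y) (c m) ≤ Γ.dist (c y) w + Γ.dist w (c m) := hΓ.dist_triangle
    have t₄ := hmax y ⟨hay, hyb⟩
    rw [SimpleGraph.dist_comm (u := w)] at t₃
    unfold Between at hw
    omega
  -- From `y` to `z` there are at most `8n + 2` steps, so `c` is geodesic there. Where the interval
  -- is cut off at `a` or `b`, the corresponding lateral side is a point.
  set y := max a (m - (4 * n + 1)) with hy
  set z := min b (m + (4 * n + 1)) with hz
  have d₁ := hc y m (by omega) (by omega)
  have d₂ := hc m z (by omega) (by omega)
  have d₃ := hc y z (by omega) (by omega)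
  have hbet : Between Γ (c y) (c m) (c z) := by
    unfold Between
    omega
  rcases hn.quadrilateral hΓ hp (hπ y) (hπ z) hbet with ⟨k, e₁, e₂, e₃⟩ | ⟨w, hw, hd⟩ |
    ⟨w, hw, hd⟩
  · have := hπmin m k e₁ e₂
    omega
  · refine key y w (by omega) (by omega) ?_ hw hd
    rcases le_total a (m - (4 * n + 1)) with h | h
    · right
      omega
    · left
      rwa [hy, max_eq_left h]
  · refine key z w (by omega) (by omega) ?_ hw hd
    rcases le_total b (m + (4 * n + 1)) with h | h
    · left
      rwa [hz, min_eq_left h]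
    · right
      rw [SimpleGraph.dist_comm]
      omega

end Realization

open Realization

/-! ### Periodic local geodesics and the bi-infinite geodesics that they follow -/

section PeriodicPath

variable {G : Type*} [Group G] {Γ : SimpleGraph G}

/-- The graph `Γ` is invariant under left multiplication, connected and locally finite. -/
structure IsCayleyLike (Γ : SimpleGraph G) : Prop where
  connected : Γ.Connected
  dist_mul : ∀ g u v : G, Γ.dist (g * u) (g * v) = Γ.dist u v
  finite_ball : ∀ r : ℕ, {g | Γ.dist 1 g ≤ r}.Finite

/-- `c` is an `N`-local geodesic through `1` that the element `g` shifts by `ℓ`. -/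
structure IsPeriodicGeod (Γ : SimpleGraph G) (N : ℕ) (g : G) (c : ℤ → G) (ℓ : ℤ) : Prop where
  local_geod : IsLocalGeod Γ c N
  zero : c 0 = 1
  add : ∀ i, c (i + ℓ) = g * c i
  pos : 0 < ℓ

variable {n : ℕ} {g : G} {c : ℤ → G} {ℓ : ℤ}

theorem IsPeriodicGeod.mul {N : ℕ} (hc : IsPeriodicGeod Γ N g c ℓ) (k : ℤ) :
    c (k * ℓ) = g ^ k := by
  induction k with
  | zero => simpa using hc.zero
  | succ k ih => rw [add_mul, one_mul, hc.add, ih, add_comm, zpow_add, zpow_one]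
  | pred k ih =>
    have := hc.add ((-(k : ℤ) - 1) * ℓ)
    rw [show (-(k : ℤ) - 1) * ℓ + ℓ = -(k : ℤ) * ℓ by ring, ih] at this
    refine mul_left_cancel (a := g) ?_
    rw [← this, ← zpow_one_add]
    congr 1
    ring

/-- If the line returned to `1`, it would stay within `2n` of the constant geodesic at `1`, yet at
time `4n + 1` it is at distance `4n + 1`. -/
theorem IsPeriodicGeod.not_isOfFinOrder (hΓ : IsCayleyLike Γ) (hn : VertexHyperbolic Γ n)
    (hc : IsPeriodicGeod Γ (8 * n + 2) g c ℓ) : ¬ IsOfFinOrder g := by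
  intro h
  obtain ⟨m, hm, hgm⟩ := h.exists_pow_eq_one
  have hℓ := hc.pos
  -- The factor `4n + 1` only ensures that this return happens no earlier than time `4n + 1`.
  have h₁ : c ((m * (4 * n + 1) : ℕ) * ℓ) = 1 := by
    rw [hc.mul, zpow_natCast, pow_mul, hgm, one_pow]
  have hle : (4 * n + 1 : ℤ) ≤ (m * (4 * n + 1) : ℕ) * ℓ := by
    have : ((4 * n + 1 : ℕ) : ℤ) ≤ (m * (4 * n + 1) : ℕ) :=
      mod_cast Nat.le_mul_of_pos_left _ hm
    push_cast at this ⊢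
    nlinarith
  have hp : IsGeod Γ (fun _ => (1 : G)) 0 0 := by
    intro i j _ _ _
    rw [SimpleGraph.dist_self]
    push_cast
    omega
  obtain ⟨k, -, -, hk⟩ := hc.local_geod.exists_dist_le hΓ.connected hn hp le_rfl hc.zero.symm
    h₁.symm (i := 4 * n + 1) (by omega) hle
  have := hc.local_geod 0 (4 * n + 1) (by omega) (by push_cast; omega)
  rw [hc.zero, SimpleGraph.dist_comm] at this
  omega

theorem IsCayleyLike.dist_zpow (hΓ : IsCayleyLike Γ) (g : G) (k l : ℤ) :
    Γ.dist (g ^ k) (g ^ l) = Γ.dist 1 (g ^ (l - k)) := by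
  rw [← hΓ.dist_mul (g ^ k) 1, mul_one, ← zpow_add, add_sub_cancel]

/-- The powers of `g` are distinct and balls are finite. -/
theorem IsCayleyLike.exists_lt_dist_zpow (hΓ : IsCayleyLike Γ) (hg : ¬ IsOfFinOrder g) (r : ℕ) :
    ∃ M : ℕ, ∀ k : ℤ, M ≤ k.natAbs → r < Γ.dist 1 (g ^ k) := by
  have hinj : Function.Injective fun k : ℤ => g ^ k :=
    injective_zpow_iff_not_isOfFinOrder.2 hg
  have hfin := (hΓ.finite_ball r).preimage hinj.injOn
  obtain ⟨B, hB⟩ := (hfin.image (fun k => k.natAbs)).bddAbove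
  refine ⟨B + 1, fun k hk => ?_⟩
  by_contra! h
  have := hB ⟨k, h, rfl⟩
  simp only at this
  omega

theorem exists_eventually_eq {α : Type*} {U : Ultrafilter ℕ} {f : ℕ → α} {F : Set α}
    (hF : F.Finite) (h : ∀ᶠ m in U, f m ∈ F) : ∃ v, ∀ᶠ m in U, f m = v := by
  obtain ⟨v, -, hv⟩ := (Ultrafilter.eventually_exists_mem_iff (P := fun v m => f m = v) hF).1
    (h.mono fun m hm => ⟨f m, hm, rfl⟩)
  exact ⟨v, hv⟩

/-- Limits of geodesics through a bounded set exist in a locally finite graph. -/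
theorem IsCayleyLike.exists_limit_geodesic (hΓ : IsCayleyLike Γ) {C : ℕ} {x : ℤ → G}
    {p : ℕ → ℤ → G} {a b : ℕ → ℤ} (hp : ∀ m, IsGeod Γ (p m) (a m) (b m))
    (ha : Tendsto a atTop atBot) (hb : Tendsto b atTop atTop)
    (h₀ : ∀ m, Γ.dist 1 (p m 0) ≤ C)
    (hx : ∀ (k : ℤ) (m : ℕ), k.natAbs ≤ m → ∃ s, a m ≤ s ∧ s ≤ b m ∧ Γ.dist (x k) (p m s) ≤ C) :
    ∃ (γ : ℤ → G) (t : ℤ → ℤ), (∀ i j, i ≤ j → (Γ.dist (γ i) (γ j) : ℤ) = j - i) ∧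
      ∀ k, Γ.dist (x k) (γ (t k)) ≤ C := by
  -- An ultrafilter replaces the diagonal argument: a sequence with values in a finite set is
  -- constant along `U`.
  set U : Ultrafilter ℕ := hyperfilter ℕ
  have hU : (U : Filter ℕ) ≤ atTop := Nat.hyperfilter_le_atTop
  have hab : ∀ i : ℤ, ∀ᶠ m in U, a m ≤ i ∧ i ≤ b m := fun i =>
    hU ((ha.eventually_le_atBot i).and (hb.eventually_ge_atTop i))
  have hd : ∀ m s, a m ≤ 0 → 0 ≤ b m → a m ≤ s → s ≤ b m →
      Γ.dist (p m 0) (p m s) = s.natAbs := by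
    intro m s h₁ h₂ h₃ h₄
    rcases le_total 0 s with h | h
    · have := hp m 0 s h₁ h h₄
      omega
    · have := hp m s 0 h₃ h h₂
      rw [SimpleGraph.dist_comm] at this
      omega
  have hγ : ∀ i, ∃ v, ∀ᶠ m in U, p m i = v := by
    intro i
    refine exists_eventually_eq (hΓ.finite_ball (C + i.natAbs)) ?_
    filter_upwards [hab i, hab 0] with m hm hm₀
    have := hd m i hm₀.1 hm₀.2 hm.1 hm.2
    have t : Γ.dist 1 (p m i) ≤ Γ.dist 1 (p m 0) + Γ.dist (p m 0) (p m i) :=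
      hΓ.connected.dist_triangle
    have := h₀ m
    change Γ.dist 1 (p m i) ≤ C + i.natAbs
    omega
  choose γ hγ using hγ
  have hs : ∀ (k : ℤ) (m : ℕ), ∃ s, k.natAbs ≤ m →
      a m ≤ s ∧ s ≤ b m ∧ Γ.dist (x k) (p m s) ≤ C := by
    intro k m
    by_cases h : k.natAbs ≤ m
    · obtain ⟨s, hs⟩ := hx k m h
      exact ⟨s, fun _ => hs⟩
    · exact ⟨0, fun h' => absurd h' h⟩
  choose s hs using hs
  have hk : ∀ k : ℤ, ∀ᶠ m : ℕ in U, k.natAbs ≤ m := fun k => hU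
    ((eventually_ge_atTop k.natAbs).mono fun m hm => by omega)
  have ht : ∀ k, ∃ v, ∀ᶠ m in U, s k m = v := by
    intro k
    -- Bounds the time `s k m`: the route from `p m 0` through `1` and `x k` to `p m (s k m)` costs
    -- at most `C + d(1, x k) + C`.
    set B : ℕ := 2 * C + Γ.dist 1 (x k)
    refine exists_eventually_eq (Set.finite_Icc (-(B : ℤ)) B) ?_
    filter_upwards [hab 0, hk k] with m hm₀ hm
    obtain ⟨h₁, h₂, h₃⟩ := hs k m hm
    have e := hd m _ hm₀.1 hm₀.2 h₁ h₂
    have t₁ : Γ.dist (p m 0) (p m (s k m)) ≤ Γ.dist (p m 0) 1 + Γ.dist 1 (p m (s k m)) :=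
      hΓ.connected.dist_triangle
    have t₂ : Γ.dist 1 (p m (s k m)) ≤ Γ.dist 1 (x k) + Γ.dist (x k) (p m (s k m)) :=
      hΓ.connected.dist_triangle
    have := h₀ m
    rw [SimpleGraph.dist_comm] at this
    simp only [Set.mem_Icc]
    omega
  choose t ht using ht
  refine ⟨γ, t, fun i j hij => ?_, fun k => ?_⟩
  · obtain ⟨m, h₁, h₂, h₃, h₄⟩ := ((hγ i).and ((hγ j).and ((hab i).and (hab j)))).exists
    rw [← h₁, ← h₂]
    exact hp m i j h₃.1 hij h₄.2
  · obtain ⟨m, h₁, h₂, h₃⟩ := ((hγ (t k)).and ((ht k).and (hk k))).exists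
    rw [← h₁, ← h₂]
    exact (hs k m h₃).2.2

/-- The orbit of `g` stays close to some bi-infinite geodesic. -/
theorem IsPeriodicGeod.exists_geodesic (hΓ : IsCayleyLike Γ) (hn : VertexHyperbolic Γ n)
    (hc : IsPeriodicGeod Γ (8 * n + 2) g c ℓ) :
    ∃ (γ : ℤ → G) (t : ℤ → ℤ), (∀ i j, i ≤ j → (Γ.dist (γ i) (γ j) : ℤ) = j - i) ∧
      ∀ k, Γ.dist (g ^ k) (γ (t k)) ≤ 2 * n := by
  have hℓ := hc.pos
  have close : ∀ (m : ℕ) (q : ℤ → G) (b : ℤ), IsGeod Γ q 0 b → 0 ≤ b → q 0 = g ^ (-(m : ℤ)) →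
      q b = g ^ (m : ℤ) → ∀ k : ℤ, k.natAbs ≤ m → ∃ s, 0 ≤ s ∧ s ≤ b ∧
        Γ.dist (g ^ k) (q s) ≤ 2 * n := by
    intro m q b hq hb h₁ h₂ k hk
    have hk₁ : -(m : ℤ) ≤ k ∧ k ≤ m := by omega
    have := hc.local_geod.exists_dist_le hΓ.connected hn hq hb (a := -(m : ℤ) * ℓ) (b := m * ℓ)
      (by rw [hc.mul, h₁]) (by rw [hc.mul, h₂]) (i := k * ℓ) (by nlinarith) (by nlinarith)
    rwa [hc.mul] at this
  choose q hq hq₀ hq₁ using fun m : ℕ =>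
    exists_isGeod hΓ.connected (g ^ (-(m : ℤ))) (g ^ (m : ℤ))
  set b : ℕ → ℤ := fun m => Γ.dist (g ^ (-(m : ℤ))) (g ^ (m : ℤ)) with hb
  -- Time at which the `m`-th geodesic is close to `g ^ 0 = 1`; shifting by it puts all geodesics
  -- through one fixed ball.
  choose j hj₀ hjb hj using fun m : ℕ =>
    close m (q m) (b m) (hq m) (by simp [hb]) (hq₀ m) (hq₁ m) 0 (by simp)
  have hunb : ∀ r : ℕ, ∀ᶠ m : ℕ in atTop, r < Γ.dist 1 (g ^ (m : ℤ)) ∧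
      r < Γ.dist 1 (g ^ (-(m : ℤ))) := by
    intro r
    obtain ⟨M, hM⟩ := hΓ.exists_lt_dist_zpow (hc.not_isOfFinOrder hΓ hn) r
    filter_upwards [eventually_ge_atTop M] with m hm
    exact ⟨hM _ (by simpa using hm), hM _ (by simpa using hm)⟩
  refine hΓ.exists_limit_geodesic (p := fun m i => q m (j m + i)) (a := fun m => 0 - j m)
    (b := fun m => b m - j m) (fun m => (hq m).shift (j m)) ?_ ?_ ?_ ?_
  · refine tendsto_atBot.2 fun B => ?_
    filter_upwards [hunb (2 * n + B.natAbs)] with m hm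
    have e := hq m 0 (j m) le_rfl (hj₀ m) (hjb m)
    have t : Γ.dist 1 (q m 0) ≤ Γ.dist 1 (q m (j m)) + Γ.dist (q m (j m)) (q m 0) :=
      hΓ.connected.dist_triangle
    have h := hj m
    rw [SimpleGraph.dist_comm (u := q m (j m)), hq₀] at t
    rw [hq₀] at e
    rw [zpow_zero] at h
    omega
  · refine tendsto_atTop.2 fun B => ?_
    filter_upwards [hunb (2 * n + B.natAbs)] with m hm
    have e := hq m (j m) (b m) (hj₀ m) (hjb m) le_rfl
    have t : Γ.dist 1 (q m (b m)) ≤ Γ.dist 1 (q m (j m)) + Γ.dist (q m (j m)) (q m (b m)) :=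
      hΓ.connected.dist_triangle
    have h := hj m
    rw [show q m (b m) = g ^ (m : ℤ) from hq₁ m] at t e
    rw [zpow_zero] at h
    omega
  · intro m
    simpa using hj m
  · intro k m hk
    obtain ⟨s, h₁, h₂, h₃⟩ := close m (q m) (b m) (hq m) (by simp [hb]) (hq₀ m) (hq₁ m) k hk
    exact ⟨s - j m, by omega, by omega, by simpa using h₃⟩

/-- The bi-infinite geodesic can be chosen such that its times `t k` close to `g ^ k` grow
linearly. -/
theorem IsPeriodicGeod.exists_geodesic_linear (hΓ : IsCayleyLike Γ) (hn : VertexHyperbolic Γ n)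
    (hc : IsPeriodicGeod Γ (8 * n + 2) g c ℓ) :
    ∃ (γ : ℤ → G) (t : ℤ → ℤ) (M E : ℕ), 0 < M ∧
      (∀ i j, i ≤ j → (Γ.dist (γ i) (γ j) : ℤ) = j - i) ∧
      (∀ k, Γ.dist (g ^ k) (γ (t k)) ≤ 2 * n) ∧
      ∀ k, (0 ≤ k → k ≤ M * (t k + E)) ∧ (k ≤ 0 → M * (t k - E) ≤ k) := by
  obtain ⟨γ, t, hγ, ht⟩ := hc.exists_geodesic hΓ hn
  -- With `12n + 1`, the times of powers at least `M` apart differ by more than `8n + 1`, after the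
  -- error `4n` in `habs`.
  obtain ⟨M₀, hM₀⟩ := hΓ.exists_lt_dist_zpow (hc.not_isOfFinOrder hΓ hn) (12 * n + 1)
  set M := M₀ + 1 with hM
  have habs : ∀ k l, (t l - t k).natAbs ≤ Γ.dist 1 (g ^ (l - k)) + 4 * n ∧
      Γ.dist 1 (g ^ (l - k)) ≤ (t l - t k).natAbs + 4 * n := by
    intro k l
    rw [← hΓ.dist_zpow]
    have e : Γ.dist (γ (t k)) (γ (t l)) = (t l - t k).natAbs := by
      rcases le_total (t k) (t l) with h | h
      · have := hγ _ _ h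
        omega
      · have := hγ _ _ h
        rw [SimpleGraph.dist_comm] at this
        omega
    have hk := ht k
    have hl := ht l
    have t₁ : Γ.dist (g ^ k) (g ^ l) ≤ Γ.dist (g ^ k) (γ (t k)) + Γ.dist (γ (t k)) (g ^ l) :=
      hΓ.connected.dist_triangle
    have t₂ : Γ.dist (γ (t k)) (g ^ l) ≤ Γ.dist (γ (t k)) (γ (t l)) + Γ.dist (γ (t l)) (g ^ l) :=
      hΓ.connected.dist_triangle
    have t₃ : Γ.dist (γ (t k)) (γ (t l)) ≤
      Γ.dist (γ (t k)) (g ^ k) + Γ.dist (g ^ k) (γ (t l)) := hΓ.connected.dist_triangle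
    have t₄ : Γ.dist (g ^ k) (γ (t l)) ≤ Γ.dist (g ^ k) (g ^ l) + Γ.dist (g ^ l) (γ (t l)) :=
      hΓ.connected.dist_triangle
    rw [SimpleGraph.dist_comm (u := γ (t l)) (v := g ^ l)] at t₂
    rw [SimpleGraph.dist_comm (u := γ (t k)) (v := g ^ k)] at t₃
    omega
  set u : ℤ → ℤ := fun j => t (j * M) with hu
  have hone : ∀ j, (u (j + 1) - u j).natAbs ≤ Γ.dist 1 (g ^ (M : ℤ)) + 4 * n ∧
      Γ.dist 1 (g ^ (M : ℤ)) ≤ (u (j + 1) - u j).natAbs + 4 * n := by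
    intro j
    have := habs (j * M) ((j + 1) * M)
    rwa [show (j + 1) * (M : ℤ) - j * M = M by ring] at this
  have htwo : ∀ j, Γ.dist 1 (g ^ (2 * M : ℤ)) ≤ (u (j + 1 + 1) - u j).natAbs + 4 * n := by
    intro j
    have := (habs (j * M) ((j + 1 + 1) * M)).2
    rwa [show (j + 1 + 1) * (M : ℤ) - j * M = 2 * M by ring] at this
  have hM₁ := hM₀ M (by omega)
  have hM₂ := hM₀ (2 * M) (by omega)
  -- No turning back: the lengths of consecutive steps agree up to `8n`, so steps of opposite sign
  -- would add up to at most `8n`, against the bound for a double step.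
  have hsign : ∀ j, 0 < u (j + 1) - u j ↔ 0 < u (j + 1 + 1) - u (j + 1) := by
    intro j
    have h₁ := hone j
    have h₂ := hone (j + 1)
    have h₃ := htwo j
    omega
  have hall : ∀ j, 0 < u (j + 1) - u j ↔ 0 < u (0 + 1) - u 0 := by
    intro j
    induction j with
    | zero => exact Iff.rfl
    | succ j ih => rw [← hsign, ih]
    | pred j ih =>
      rw [hsign, ← ih]
      simp
  obtain ⟨E₀, hE₀⟩ : ∃ E₀ : ℕ, ∀ k, (t k - u (k / M)).natAbs ≤ E₀ := by
    refine ⟨∑ r ∈ Finset.range M, Γ.dist 1 (g ^ (r : ℤ)) + 4 * n, fun k => ?_⟩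
    have h₁ := (habs (k / M * M) k).1
    have h₂ : k - k / M * M = k % M := by
      have := Int.mul_ediv_add_emod k M
      rw [mul_comm] at this
      omega
    have h₃ : 0 ≤ k % (M : ℤ) := Int.emod_nonneg _ (by omega)
    have h₄ : k % (M : ℤ) < M := Int.emod_lt_of_pos _ (by omega)
    rw [h₂, ← Int.toNat_of_nonneg h₃] at h₁
    have h₅ := Finset.single_le_sum (f := fun r : ℕ => Γ.dist 1 (g ^ (r : ℤ)))
      (fun _ _ => Nat.zero_le _) (Finset.mem_range.2 (by omega : (k % (M : ℤ)).toNat < M))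
    have h₆ : u (k / M) = t (k / M * M) := rfl
    omega
  -- The case of increasing times.
  have main : ∀ (t' u' : ℤ → ℤ), (∀ j, 0 < u' (j + 1) - u' j) →
      (∀ k, (t' k - u' (k / M)).natAbs ≤ E₀) → ∃ E : ℕ,
      ∀ k, (0 ≤ k → k ≤ M * (t' k + E)) ∧ (k ≤ 0 → M * (t' k - E) ≤ k) := by
    intro t' u' hpos hE
    have hmono : ∀ i j, i ≤ j → j - i ≤ u' j - u' i := by
      intro i j hij
      induction j, hij using Int.leInduction with
      | base => simp
      | succ j _ ih =>
        have := hpos j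
        omega
    -- The `1` absorbs the remainder of `k` modulo `M`.
    refine ⟨E₀ + (u' 0).natAbs + 1, fun k => ?_⟩
    have h₁ := Int.mul_ediv_add_emod k M
    have h₃ : 0 ≤ k % (M : ℤ) := Int.emod_nonneg _ (by omega)
    have h₄ : k % (M : ℤ) < M := Int.emod_lt_of_pos _ (by omega)
    have h₅ := hE k
    have hMpos : (0 : ℤ) < M := by omega
    constructor
    · intro hk
      have := hmono 0 (k / M) (Int.ediv_nonneg hk hMpos.le)
      have : k / M + 1 ≤ t' k + (E₀ + (u' 0).natAbs + 1 : ℕ) := by omega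
      nlinarith
    · intro hk
      have := hmono (k / M) 0 (by by_contra! h; nlinarith)
      have : t' k - (E₀ + (u' 0).natAbs + 1 : ℕ) ≤ k / M := by omega
      nlinarith
  by_cases hpos : 0 < u (0 + 1) - u 0
  · obtain ⟨E, hE⟩ := main t u (fun j => (hall j).2 hpos) hE₀
    exact ⟨γ, t, M, E, by omega, hγ, ht, hE⟩
  · obtain ⟨E, hE⟩ := main (fun k => -t k) (fun j => -u j)
      (fun j => by
        have := (hall j).not.2 hpos
        have := hone j
        omega)
      (fun k => by
        have := hE₀ k
        omega)
    refine ⟨fun i => γ (-i), fun k => -t k, M, E, by omega, fun i j hij => ?_, fun k => ?_, hE⟩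
    · rw [SimpleGraph.dist_comm, hγ _ _ (by omega)]
      ring
    · simp only [neg_neg]
      exact ht k

end PeriodicPath

/-! ### Gromov products and quadrilaterals in a hyperbolic space -/

section Metric

variable {X : Type*} [MetricSpace X]

theorem IsGeodesicSegment.gromovProduct_le {x y q : X} {σ : Set X} (h : IsGeodesicSegment x y σ)
    (hq : q ∈ σ) (p : X) : gromovProduct p x y ≤ dist p q := by
  obtain ⟨c, h₀, h₁, hc, rfl⟩ := h
  obtain ⟨t, ht, rfl⟩ := hq
  have hd : 0 ≤ dist x y := dist_nonneg
  have e₁ := hc t ht 0 ⟨le_rfl, hd⟩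
  have e₂ := hc t ht (dist x y) ⟨hd, le_rfl⟩
  rw [h₀, sub_zero, abs_of_nonneg ht.1] at e₁
  rw [h₁, abs_sub_comm, abs_of_nonneg (by linarith [ht.2])] at e₂
  have t₁ := dist_triangle p (c t) x
  have t₂ := dist_triangle p (c t) y
  unfold gromovProduct
  linarith

theorem gromovProduct_comm (p x y : X) : gromovProduct p x y = gromovProduct p y x := by
  unfold gromovProduct
  rw [dist_comm x y]
  ring

theorem isGeodesicSegment_image {γ : ℝ → X} (hγ : Isometry γ) {a b : ℝ} (hab : a ≤ b) :
    IsGeodesicSegment (γ a) (γ b) (γ '' Set.Icc a b) := by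
  have hd : dist (γ a) (γ b) = b - a := by
    rw [hγ.dist_eq, Real.dist_eq, abs_sub_comm, abs_of_nonneg (by linarith)]
  refine ⟨fun t => γ (t + a), by simp, by simp [hd], fun s _ t _ => ?_, ?_⟩
  · rw [hγ.dist_eq, Real.dist_eq, add_sub_add_right_eq_sub]
  · rw [hd]
    ext x
    constructor
    · rintro ⟨t, ht, rfl⟩
      exact ⟨t - a, ⟨by linarith [ht.1], by linarith [ht.2]⟩, by simp⟩
    · rintro ⟨t, ht, rfl⟩
      exact ⟨t + a, ⟨by linarith [ht.1], by linarith [ht.2]⟩, rfl⟩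

/-- Points close to a geodesic line at times tending to infinity converge to its end point. -/
theorem tendsto_gromovProduct {c : ℝ → X} (hc : Isometry c) {y : ℕ → X} {s : ℕ → ℝ} {C : ℝ}
    (hs : Tendsto s atTop atTop) (hy : ∀ m, dist (y m) (c (s m)) ≤ C) (p : X) :
    Tendsto (fun q : ℝ × ℕ => gromovProduct p (c q.1) (y q.2)) (atTop ×ˢ atTop) atTop := by
  refine tendsto_atTop.2 fun B => ?_
  set K := dist p (c 0)
  have h₁ : ∀ᶠ r : ℝ in atTop, B + K + C ≤ r := eventually_ge_atTop _
  have h₂ : ∀ᶠ m : ℕ in atTop, B + K + C ≤ s m := hs.eventually_ge_atTop _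
  filter_upwards [h₁.prod_mk h₂] with q hq
  have d₁ : q.1 ≤ dist (c 0) (c q.1) := by
    rw [hc.dist_eq, Real.dist_eq, zero_sub, abs_neg]
    exact le_abs_self _
  have d₂ : s q.2 ≤ dist (c 0) (c (s q.2)) := by
    rw [hc.dist_eq, Real.dist_eq, zero_sub, abs_neg]
    exact le_abs_self _
  have d₃ : dist (c q.1) (c (s q.2)) = |q.1 - s q.2| := by rw [hc.dist_eq, Real.dist_eq]
  have t₁ := dist_triangle (c 0) p (c q.1)
  have t₂ := dist_triangle4 (c 0) p (y q.2) (c (s q.2))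
  have t₃ := dist_triangle (c q.1) (c (s q.2)) (y q.2)
  have hC := hy q.2
  rw [dist_comm (c 0) p] at t₁ t₂
  rw [dist_comm (c (s q.2)) (y q.2)] at t₃
  change B ≤ (dist p (c q.1) + dist p (y q.2) - dist (c q.1) (y q.2)) / 2
  rcases abs_cases (q.1 - s q.2) with h | h <;> linarith [hq.1, hq.2]

/-- Cut the quadrilateral along the diagonal from `a` to `y`. The sides `[z, a]` and `[y, b]` are at
distance more than `C + 2δ` from `p`, since a Gromov product bounds the distance to a side from
below; so only `τ` can be near `s`. -/
theorem IsHyperbolic.quadrilateral {δ : ℝ} (hδ : IsHyperbolic X δ) {y z a b s p : X} {σ τ : Set X}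
    (hσ : IsGeodesicSegment y z σ) (hτ : IsGeodesicSegment b a τ) (hs : s ∈ σ) {C : ℝ}
    (hp : dist p s ≤ C) (hza : C + 2 * δ < gromovProduct p a z)
    (hyb : C + 2 * δ < gromovProduct p b y) : ∃ q ∈ τ, dist p q ≤ C + 2 * δ := by
  obtain ⟨e₁, he₁⟩ := hδ.1 z a
  obtain ⟨e₂, he₂⟩ := hδ.1 a y
  obtain ⟨e₃, he₃⟩ := hδ.1 y b
  have hδ₀ : 0 ≤ δ := by
    obtain ⟨q, -, hq⟩ := hδ.2 _ _ _ _ _ _ hσ he₁ he₂ s hs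
    exact dist_nonneg.trans hq
  rw [gromovProduct_comm] at hza hyb
  obtain ⟨q, hq | hq, hsq⟩ := hδ.2 _ _ _ _ _ _ hσ he₁ he₂ s hs
  · have := he₁.gromovProduct_le hq p
    have := dist_triangle p s q
    linarith
  · obtain ⟨r, hr | hr, hqr⟩ := hδ.2 _ _ _ _ _ _ he₂ he₃ hτ q hq
    · have := he₃.gromovProduct_le hr p
      have := dist_triangle4 p s q r
      linarith
    · have := dist_triangle4 p s q r
      exact ⟨r, hr, by linarith⟩

end Metric

/-! ### Translation length and axes in the Cayley graph -/

section Cayley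

variable {G : Type*} [Group G] {S : Set G} {hS : Subgroup.closure S = ⊤}

theorem isCayleyLike (hS : Subgroup.closure S = ⊤) (hfin : S.Finite) :
    IsCayleyLike (SimpleGraph.mulCayley S) := by
  have hΓ := cayley_connected hS
  refine ⟨hΓ, ?_, ?_⟩
  · have h : ∀ g u v : G, (SimpleGraph.mulCayley S).dist (g * u) (g * v) ≤
        (SimpleGraph.mulCayley S).dist u v := by
      intro g u v
      obtain ⟨w, hw⟩ := hΓ.exists_walk_length_eq_dist u v
      let f : SimpleGraph.mulCayley S →g SimpleGraph.mulCayley S :=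
        ⟨fun x => g * x, fun h => SimpleGraph.mulCayley_adj_mul_iff_right.2 h⟩
      rw [← hw, ← w.length_map f]
      exact SimpleGraph.dist_le _
    intro g u v
    refine le_antisymm (h g u v) ?_
    simpa using h g⁻¹ (g * u) (g * v)
  · intro r
    induction r with
    | zero =>
      refine (Set.finite_singleton 1).subset fun g hg => ?_
      exact (hΓ.dist_eq_zero_iff.1 (Nat.le_zero.1 hg)).symm
    | succ r ih =>
      -- An element of length `r + 1` is one of length `r` times a letter, the last edge of a
      -- geodesic.
      refine (ih.union (Set.Finite.image2 (· * ·) ih (hfin.union hfin.inv))).subset fun g hg => ?_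
      rcases Nat.lt_or_ge r ((SimpleGraph.mulCayley S).dist 1 g) with h | h
      · have hd : (SimpleGraph.mulCayley S).dist 1 g = r + 1 := le_antisymm hg h
        obtain ⟨p, hp, hp₀, hp₁⟩ := exists_isGeod hΓ 1 g
        rw [hd] at hp hp₁
        push_cast at hp hp₁
        have hadj := hp.adj (i := r) (by omega) le_rfl
        have hr := hp 0 r le_rfl (by omega) (by omega)
        rw [hp₀] at hr
        rw [hp₁] at hadj
        right
        refine ⟨p r, ?_, (p r)⁻¹ * g, ?_, by simp⟩
        · change (SimpleGraph.mulCayley S).dist 1 (p r) ≤ r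
          omega
        · obtain ⟨-, h | h⟩ := (SimpleGraph.mulCayley_adj S _ _).1 hadj
          · exact Or.inl h
          · exact Or.inr (by simpa using h)
      · exact Or.inl h

theorem smul_cayleyVertex (g u : G) :
    g • cayleyVertex S hS u = cayleyVertex S hS (g * u) :=
  coord_injective (funext fun w => edgeCoord_mul g u u 0 w)

variable {δ : ℝ} {g : G} {c : ℤ → G} {ℓ : ℤ}

/-- Fekete's lemma gives the limit. It is at least `1 / M`, because `g ^ m` advances along the
bi-infinite geodesic by at least `m / M` up to a constant. -/
theorem IsPeriodicGeod.actsLoxodromically (hfin : S.Finite)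
    (hδ : IsHyperbolic (CayleySpace S hS) δ)
    (hc : IsPeriodicGeod (SimpleGraph.mulCayley S) (8 * ⌊δ⌋₊ + 2) g c ℓ) :
    ActsLoxodromically (cayleyVertex S hS 1) g := by
  have hΓ := isCayleyLike hS hfin
  set Γ := SimpleGraph.mulCayley S with hΓ'
  obtain ⟨γ, t, M, E, hM, hγ, ht, hlin⟩ :=
    hc.exists_geodesic_linear hΓ (vertexHyperbolic (hΓ := cayley_connected hS) hδ)
  have hdist : ∀ m : ℕ, dist (cayleyVertex S hS 1) (g ^ m • cayleyVertex S hS 1) =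
      Γ.dist 1 (g ^ m) := by
    intro m
    rw [smul_cayleyVertex, mul_one]
    exact dist_vertex _ _
  simp only [ActsLoxodromically, hdist]
  have hsub : Subadditive fun m : ℕ => (Γ.dist 1 (g ^ m) : ℝ) := by
    intro k m
    have h₁ : Γ.dist 1 (g ^ (k + m)) ≤ Γ.dist 1 (g ^ k) + Γ.dist (g ^ k) (g ^ (k + m)) :=
      hΓ.connected.dist_triangle
    have h₂ : Γ.dist (g ^ k) (g ^ (k + m)) = Γ.dist 1 (g ^ m) := by
      rw [pow_add, ← hΓ.dist_mul (g ^ k) 1, mul_one]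
    rw [h₂] at h₁
    beta_reduce
    exact mod_cast h₁
  have hlim := hsub.tendsto_lim ⟨0, by
    rintro _ ⟨m, rfl⟩
    positivity⟩
  refine ⟨_, ?_, hlim⟩
  have hMpos : (0 : ℝ) < M := mod_cast hM
  refine lt_of_lt_of_le (one_div_pos.2 hMpos) ?_
  obtain ⟨K, hK⟩ : ∃ K : ℕ, K = E + (t 0).natAbs + 4 * ⌊δ⌋₊ := ⟨_, rfl⟩
  have hlow : ∀ m : ℕ, (m : ℝ) / M - K ≤ Γ.dist 1 (g ^ m) := by
    intro m
    have h₁ := (hlin m).1 (by omega)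
    have h₂ : t m - t 0 ≤ Γ.dist (γ (t 0)) (γ (t m)) := by
      rcases le_total (t 0) (t m) with h | h
      · exact (hγ _ _ h).ge
      · omega
    have h₃ : Γ.dist (γ (t 0)) (γ (t m)) ≤ Γ.dist (γ (t 0)) 1 + Γ.dist 1 (γ (t m)) :=
      hΓ.connected.dist_triangle
    have h₄ : Γ.dist 1 (γ (t m)) ≤ Γ.dist 1 (g ^ m) + Γ.dist (g ^ m) (γ (t m)) :=
      hΓ.connected.dist_triangle
    have h₅ := ht 0
    have h₆ := ht m
    rw [zpow_zero, SimpleGraph.dist_comm] at h₅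
    rw [zpow_natCast] at h₆
    have h₇ : t m + E ≤ Γ.dist 1 (g ^ m) + K := by omega
    have h₈ : (t m + E : ℝ) ≤ Γ.dist 1 (g ^ m) + K :=
      mod_cast h₇
    have h₉ : (m : ℝ) ≤ M * (t m + E) := mod_cast h₁
    rw [sub_le_iff_le_add, div_le_iff₀' hMpos]
    exact h₉.trans (mul_le_mul_of_nonneg_left h₈ hMpos.le)
  have hlim' : Tendsto (fun m : ℕ => 1 / (M : ℝ) - (K : ℝ) / m) atTop (𝓝 (1 / M - 0)) :=
    tendsto_const_nhds.sub (tendsto_const_div_atTop_nhds_zero_nat (K : ℝ))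
  rw [sub_zero] at hlim'
  refine le_of_tendsto_of_tendsto hlim' hlim ?_
  filter_upwards [eventually_gt_atTop 0] with m hm
  have hm' : (0 : ℝ) < m := mod_cast hm
  rw [le_div_iff₀ hm', sub_mul, div_mul_cancel₀ _ hm'.ne']
  have := hlow m
  rwa [one_div_mul_eq_div]

/-- The limit geodesic is an axis: the times of the powers near it tend to `±∞` in the right
directions by the linear bounds. -/
theorem IsPeriodicGeod.exists_isAxis (hfin : S.Finite) (hδ : IsHyperbolic (CayleySpace S hS) δ)
    (hc : IsPeriodicGeod (SimpleGraph.mulCayley S) (8 * ⌊δ⌋₊ + 2) g c ℓ) :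
    ∃ γ : ℝ → CayleySpace S hS, IsAxis (cayleyVertex S hS 1) g γ := by
  have hΓ := isCayleyLike hS hfin
  obtain ⟨γ, t, M, E, hM, hγ, ht, hlin⟩ :=
    hc.exists_geodesic_linear hΓ (vertexHyperbolic (hΓ := cayley_connected hS) hδ)
  have hgeod : ∀ a b, IsGeod (SimpleGraph.mulCayley S) γ a b := fun a b i j _ h _ => hγ i j h
  have hstep : ∀ i, γ i = γ (i + 1) ∨ (SimpleGraph.mulCayley S).Adj (γ i) (γ (i + 1)) :=
    fun i => Or.inr ((hgeod i (i + 1)).adj le_rfl le_rfl)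
  set c : ℝ → CayleySpace S hS := path γ hstep with hcdef
  have hle : ∀ r s : ℝ, r ≤ s → dist (c r) (c s) = s - r := fun r s hrs =>
    (hgeod ⌊r⌋ ⌈s⌉).dist_path hstep (Int.floor_le r) hrs (Int.le_ceil s)
  have hiso : Isometry c := by
    refine Isometry.of_dist_eq fun r s => ?_
    rcases le_total r s with h | h
    · rw [hle r s h, Real.dist_eq, abs_sub_comm, abs_of_nonneg (by linarith)]
    · rw [dist_comm, hle s r h, Real.dist_eq, abs_of_nonneg (by linarith)]
  have hneg : Isometry fun r : ℝ => c (-r) := hiso.comp (IsometryEquiv.neg ℝ).isometry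
  have hclose : ∀ k : ℤ, dist (g ^ k • cayleyVertex S hS 1) (c (t k)) ≤ 2 * ⌊δ⌋₊ := by
    intro k
    rw [smul_cayleyVertex, mul_one, hcdef, path_intCast, cayleyVertex, dist_vertex]
    exact mod_cast ht k
  have hpos : Tendsto (fun m : ℕ => t m) atTop atTop := by
    refine tendsto_atTop.2 fun B => ?_
    filter_upwards [eventually_ge_atTop (M * (B + E)).toNat] with m hm
    have h₁ := (hlin m).1 (by omega)
    have h₂ : M * (B + E) ≤ M * (t m + E) := by omega
    have := le_of_mul_le_mul_left h₂ (by omega)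
    omega
  have hneg' : Tendsto (fun m : ℕ => -t (-(m : ℤ))) atTop atTop := by
    refine tendsto_atTop.2 fun B => ?_
    filter_upwards [eventually_ge_atTop (M * (B + E)).toNat] with m hm
    have h₁ := (hlin (-m)).2 (by omega)
    have h₂ : M * (t (-m) - E) ≤ M * (-B - E) := by
      have : M * (-B - E) = -(M * (B + E)) := by ring
      omega
    have := le_of_mul_le_mul_left h₂ (by omega)
    omega
  refine ⟨c, hiso, ?_, ?_⟩
  · exact tendsto_gromovProduct hiso (y := fun m => g ^ m • cayleyVertex S hS 1)
      ((tendsto_intCast_atTop_atTop (R := ℝ)).comp hpos)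
      (fun m => by
        have := hclose m
        rwa [zpow_natCast] at this) (cayleyVertex S hS 1)
  · exact tendsto_gromovProduct hneg (y := fun m => g⁻¹ ^ m • cayleyVertex S hS 1)
      ((tendsto_intCast_atTop_atTop (R := ℝ)).comp hneg')
      (fun m => by
        have := hclose (-m)
        rw [zpow_neg, ← inv_zpow, zpow_natCast] at this
        simpa using this) (cayleyVertex S hS 1)

theorem IsPeriodicGeod.exists_dist_axis_le (hfin : S.Finite)
    (hδ : IsHyperbolic (CayleySpace S hS) δ)
    (hc : IsPeriodicGeod (SimpleGraph.mulCayley S) (8 * ⌊δ⌋₊ + 2) g c ℓ)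
    {γ : ℝ → CayleySpace S hS} (hγ : IsAxis (cayleyVertex S hS 1) g γ) :
    ∃ t : ℝ, dist (cayleyVertex S hS 1) (γ t) ≤ 2 * ⌊δ⌋₊ + 2 * δ := by
  obtain ⟨hiso, h₁, h₂⟩ := hγ
  -- Go far enough along the axis and the orbit for the lateral sides of the quadrilateral `g⁻ᵐ, gᵐ,
  -- γ T, γ (-T)` to miss the relevant ball around `1`.
  obtain ⟨⟨T, m⟩, hT, hp, hm⟩ := ((eventually_ge_atTop (0 : ℝ)).prod_inl atTop |>.and
    ((h₁.eventually_gt_atTop (2 * ⌊δ⌋₊ + 2 * δ)).and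
      (h₂.eventually_gt_atTop (2 * ⌊δ⌋₊ + 2 * δ)))).exists
  simp only at hT hp hm
  have hΓ := isCayleyLike hS hfin
  have hℓ := hc.pos
  obtain ⟨q, hq, hq₀, hq₁⟩ := exists_isGeod hΓ.connected (g ^ (-(m : ℤ))) (g ^ (m : ℤ))
  obtain ⟨k, hk₀, hk₁, hk⟩ := hc.local_geod.exists_dist_le hΓ.connected
    (vertexHyperbolic (hΓ := cayley_connected hS) hδ) hq (by omega) (a := -(m : ℤ) * ℓ)
    (b := m * ℓ) (by rw [hc.mul, hq₀]) (by rw [hc.mul, hq₁]) (i := 0) (by nlinarith)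
    (by nlinarith)
  have hseg := hq.isGeodesicSegment (hΓ := cayley_connected hS) (by omega)
  rw [hq₀, hq₁] at hseg
  rw [smul_cayleyVertex, mul_one, ← zpow_natCast] at hp hm
  rw [inv_zpow, ← zpow_neg] at hm
  obtain ⟨x, ⟨t, -, rfl⟩, ht⟩ := hδ.quadrilateral hseg
    (isGeodesicSegment_image hiso (by linarith : -T ≤ T))
    (hq.vertex_mem_segment (hΓ := cayley_connected hS) hk₀ hk₁)
    (p := cayleyVertex S hS 1) (C := 2 * ⌊δ⌋₊)
    (by
      rw [cayleyVertex, dist_vertex]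
      rw [hc.zero] at hk
      exact mod_cast hk) hp hm
  exact ⟨t, ht⟩

end Cayley

/-! ### Words, their periodic lines, and bounded continuations -/

section Words

variable {G : Type*} [Group G] {S : Set G} {hS : Subgroup.closure S = ⊤}

/-- All letters of the word `w` are in `S ∪ S⁻¹`. -/
def IsWordIn (S : Set G) (w : List G) : Prop := ∀ a ∈ w, a ∈ S ∨ a⁻¹ ∈ S

theorem IsWordIn.of_infix {v w : List G} (hw : IsWordIn S w) (h : v <:+: w) : IsWordIn S v :=
  fun a ha => hw a (h.subset ha)

theorem isGeodesicWord_iff {w : List G} :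
    IsGeodesicWord S hS w ↔ (SimpleGraph.mulCayley S).dist 1 w.prod = w.length := by
  unfold IsGeodesicWord cayleyVertex
  rw [dist_vertex, Nat.cast_inj]

theorem IsCayleyLike.dist_one_mul_le {Γ : SimpleGraph G} (hΓ : IsCayleyLike Γ) (x y : G) :
    Γ.dist 1 (x * y) ≤ Γ.dist 1 x + Γ.dist 1 y := by
  have : Γ.dist 1 (x * y) ≤ Γ.dist 1 x + Γ.dist x (x * y) := hΓ.connected.dist_triangle
  have h := hΓ.dist_mul x 1 y
  rw [mul_one] at h
  omega

theorem dist_one_letter_le {a : G} (ha : a ∈ S ∨ a⁻¹ ∈ S) :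
    (SimpleGraph.mulCayley S).dist 1 a ≤ 1 := by
  by_cases h : a = 1
  · rw [h, SimpleGraph.dist_self]
    exact zero_le_one
  · refine (SimpleGraph.dist_eq_one_iff_adj.2 ?_).le
    rw [SimpleGraph.mulCayley_adj]
    exact ⟨fun h' => h h'.symm, by simpa using ha⟩

theorem IsWordIn.dist_prod_le (hΓ : IsCayleyLike (SimpleGraph.mulCayley S)) {w : List G}
    (hw : IsWordIn S w) : (SimpleGraph.mulCayley S).dist 1 w.prod ≤ w.length := by
  induction w with
  | nil => simp
  | cons a w ih =>
    rw [List.prod_cons, List.length_cons]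
    have h₁ := hΓ.dist_one_mul_le a w.prod
    have h₂ := dist_one_letter_le (hw a (by simp))
    have h₃ := ih fun b hb => hw b (by simp [hb])
    omega

/-- A shortcut for the subword would be a shortcut for the whole word. -/
theorem IsWordIn.geodesic_of_infix (hΓ : IsCayleyLike (SimpleGraph.mulCayley S)) {v w : List G}
    (hw : IsWordIn S w) (hgeo : (SimpleGraph.mulCayley S).dist 1 w.prod = w.length)
    (h : v <:+: w) : (SimpleGraph.mulCayley S).dist 1 v.prod = v.length := by
  have hv := (hw.of_infix h).dist_prod_le hΓ
  obtain ⟨s, t, rfl⟩ := h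
  have hs : IsWordIn S s := fun a ha => hw a (by simp [ha])
  have ht : IsWordIn S t := fun a ha => hw a (by simp [ha])
  have h₁ := hs.dist_prod_le hΓ
  have h₂ := ht.dist_prod_le hΓ
  simp only [List.prod_append, List.length_append] at hgeo
  have h₃ := hΓ.dist_one_mul_le (s.prod * v.prod) t.prod
  have h₄ := hΓ.dist_one_mul_le s.prod v.prod
  omega

theorem exists_isWordIn_of_walk {u v : G} (p : (SimpleGraph.mulCayley S).Walk u v) :
    ∃ w, IsWordIn S w ∧ u * w.prod = v ∧ w.length = p.length := by
  induction p with
  | nil => exact ⟨[], by simp [IsWordIn], by simp, rfl⟩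
  | @cons u v x huv p ih =>
    obtain ⟨w, h₁, h₂, h₃⟩ := ih
    refine ⟨u⁻¹ * v :: w, ?_, by simp [mul_assoc, h₂], by simp [h₃]⟩
    intro a ha
    rcases List.mem_cons.1 ha with rfl | ha
    · simpa using ((SimpleGraph.mulCayley_adj S _ _).1 huv).2
    · exact h₁ a ha

theorem exists_geodesic_word (hS : Subgroup.closure S = ⊤) (g : G) :
    ∃ w, IsWordIn S w ∧ w.prod = g ∧
      (SimpleGraph.mulCayley S).dist 1 w.prod = w.length := by
  obtain ⟨p, hp⟩ := (cayley_connected hS).exists_walk_length_eq_dist 1 g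
  obtain ⟨w, h₁, h₂, h₃⟩ := exists_isWordIn_of_walk p
  rw [one_mul] at h₂
  exact ⟨w, h₁, h₂, by rw [h₂, h₃, hp]⟩

/-- The vertices on the line labelled by the powers of the word `p`. -/
def wordLine (p : List G) (i : ℤ) : G :=
  p.prod ^ (i / (p.length : ℤ)) * (p.take (i % (p.length : ℤ)).toNat).prod

/-- The next period again starts with `w`, so positions up to `|w|` beyond the period can be read
off from `w ++ f ++ w`. Thus a short window of the line is a subword of it. -/
theorem wordLine_mul_add {w f : List G} {r : ℕ} (hr : r < (w ++ f).length + w.length) (q : ℤ) :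
    wordLine (w ++ f) (q * ((w ++ f).length : ℤ) + r) =
      (w ++ f).prod ^ q * ((w ++ f ++ w).take r).prod := by
  have key : ∀ (r : ℕ) (q : ℤ), r < (w ++ f).length →
      wordLine (w ++ f) (q * ((w ++ f).length : ℤ) + r) =
        (w ++ f).prod ^ q * ((w ++ f).take r).prod := by
    intro r q h
    have h' : (r : ℤ) < (w ++ f).length := mod_cast h
    have h₁ : (q * ((w ++ f).length : ℤ) + r) / ((w ++ f).length : ℤ) = q := by
      rw [add_comm, Int.add_mul_ediv_right _ _ (by omega),
        Int.ediv_eq_zero_of_lt (by omega) h', zero_add]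
    have h₂ : (q * ((w ++ f).length : ℤ) + r) % ((w ++ f).length : ℤ) = r := by
      rw [add_comm, Int.add_mul_emod_self_right, Int.emod_eq_of_lt (by omega) h']
    rw [wordLine, h₁, h₂, Int.toNat_natCast]
  rcases Nat.lt_or_ge r (w ++ f).length with h | h
  · rw [key r q h, List.take_append_of_le_length (l₁ := w ++ f) h.le]
  · obtain ⟨s, rfl⟩ := Nat.exists_eq_add_of_le h
    have hs : s < w.length := by omega
    have := key s (q + 1) (by rw [List.length_append]; omega)
    rw [show q * ((w ++ f).length : ℤ) + ((w ++ f).length + s : ℕ) =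
      (q + 1) * ((w ++ f).length : ℤ) + s by push_cast; ring, this,
      List.take_append_of_le_length hs.le, List.take_length_add_append,
      List.prod_append (l₁ := w ++ f), zpow_add_one, mul_assoc]

/-- A word `w ++ f` labels a periodic local geodesic if the short subwords of `w ++ f ++ w` are
geodesic. -/
theorem isPeriodicGeod_wordLine (hΓ : IsCayleyLike (SimpleGraph.mulCayley S)) {w f : List G}
    {N : ℕ} (hN : 0 < N) (hNw : N ≤ w.length)
    (h : ∀ v, v <:+: w ++ f ++ w → v.length ≤ N →
      (SimpleGraph.mulCayley S).dist 1 v.prod = v.length) :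
    IsPeriodicGeod (SimpleGraph.mulCayley S) N (w ++ f).prod (wordLine (w ++ f))
      ((w ++ f).length : ℤ) := by
  have hpos : (0 : ℤ) < ((w ++ f).length : ℤ) := by
    rw [List.length_append]
    omega
  refine ⟨fun i j hij hj => ?_, by simp [wordLine], fun i => ?_, hpos⟩
  · set ℓ : ℤ := ((w ++ f).length : ℤ) with hℓ
    have h₁ := Int.mul_ediv_add_emod i ℓ
    have h₂ := Int.emod_nonneg i hpos.ne'
    have h₃ := Int.emod_lt_of_pos i hpos
    obtain ⟨r, hr⟩ := Int.eq_ofNat_of_zero_le h₂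
    obtain ⟨m, hm⟩ := Int.le.dest hij
    have hi : i = i / ℓ * ℓ + r := by rw [mul_comm]; omega
    have hj' : j = i / ℓ * ℓ + (r + m : ℕ) := by push_cast; omega
    have e₁ := wordLine_mul_add (w := w) (f := f) (r := r) (by omega) (i / ℓ)
    have e₂ := wordLine_mul_add (w := w) (f := f) (r := r + m) (by omega) (i / ℓ)
    rw [← hℓ, ← hi] at e₁
    rw [← hℓ, ← hj'] at e₂
    rw [e₁, e₂, hΓ.dist_mul, List.take_add, List.prod_append]
    nth_rw 1 [← mul_one ((w ++ f ++ w).take r).prod]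
    have hlen : (((w ++ f ++ w).drop r).take m).length = m := by
      rw [List.length_take, List.length_drop, List.length_append]
      omega
    rw [hΓ.dist_mul, h _ ((List.take_prefix _ _).isInfix.trans (List.drop_suffix _ _).isInfix)
      (by omega), hlen]
    omega
  · unfold wordLine
    rw [Int.add_ediv_of_dvd_right dvd_rfl, Int.ediv_self hpos.ne', Int.add_emod_right,
      add_comm, zpow_add, zpow_one, mul_assoc]

theorem infix_of_append_eq {α : Type*} {x y z s v t : List α} (h : s ++ v ++ t = x ++ y ++ z)
    (hs : x.length ≤ s.length) (ht : z.length ≤ t.length) : v <:+: y := by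
  obtain ⟨s', rfl⟩ : x <+: s := by
    refine List.prefix_of_prefix_length_le (l₃ := s ++ v ++ t) ?_ ?_ hs
    · rw [h]
      exact ⟨y ++ z, by simp⟩
    · exact ⟨v ++ t, by simp⟩
  obtain ⟨t', rfl⟩ : z <:+ t := by
    refine List.suffix_of_suffix_length_le (l₃ := x ++ s' ++ v ++ t) ?_ ?_ ht
    · rw [h]
      exact ⟨x ++ y, by simp⟩
    · exact ⟨x ++ s' ++ v, by simp⟩
  refine ⟨s', t', ?_⟩
  simp only [List.append_assoc, List.append_cancel_left_eq] at h
  simp only [← List.append_assoc, List.append_cancel_right_eq] at h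
  exact h

/-- A subword of length at most `K` that starts before the last `K` letters of the first `w` ends
inside that copy; symmetrically for the second copy. -/
theorem infix_or_infix_of_length_le {α : Type*} {w f v : List α} {K : ℕ} (hK : K ≤ w.length)
    (hv : v <:+: w ++ f ++ w) (hvK : v.length ≤ K) :
    v <:+: w ∨ v <:+: w.drop (w.length - K) ++ f ++ w.take K := by
  obtain ⟨s, t, h⟩ := hv
  have hlen := congrArg List.length h
  simp only [List.length_append] at hlen
  have e₁ : w.take (w.length - K) ++ w.drop (w.length - K) = w := List.take_append_drop _ _
  have e₂ : w.take K ++ w.drop K = w := List.take_append_drop _ _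
  have l₁ : (w.take (w.length - K)).length = w.length - K := by
    rw [List.length_take]
    omega
  have l₂ : (w.drop K).length = w.length - K := List.length_drop
  rcases Nat.lt_or_ge s.length (w.length - K) with hs | hs
  · left
    refine infix_of_append_eq (x := []) (z := f ++ w) (h.trans (by simp)) (by simp) ?_
    rw [List.length_append]
    omega
  · rcases Nat.lt_or_ge t.length (w.length - K) with ht | ht
    · left
      refine infix_of_append_eq (x := w ++ f) (z := []) (h.trans (by simp)) ?_ (by simp)
      rw [List.length_append]
      omega
    · right
      refine infix_of_append_eq (x := w.take (w.length - K)) (z := w.drop K) (h.trans ?_)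
        (by omega) (by omega)
      calc w ++ f ++ w = w.take (w.length - K) ++ w.drop (w.length - K) ++ f ++
            (w.take K ++ w.drop K) := by rw [e₁, e₂]
        _ = _ := by simp only [List.append_assoc]

theorem finite_isWordIn (hfin : S.Finite) (K : ℕ) :
    {w : List G | IsWordIn S w ∧ w.length = K}.Finite := by
  have hT : {a : G | a ∈ S ∨ a⁻¹ ∈ S}.Finite := hfin.union hfin.inv
  have := hT.to_subtype
  refine ((List.finite_length_eq {a : G | a ∈ S ∨ a⁻¹ ∈ S} K).image
    (List.map Subtype.val)).subset ?_
  rintro w ⟨hw, hK⟩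
  lift w to List {a : G | a ∈ S ∨ a⁻¹ ∈ S} using hw
  refine ⟨w, ?_, rfl⟩
  rwa [List.length_map] at hK

/-- Every geodesic word `w` of length at least `K` has a continuation `f` of length at most `D`
such that the subwords of `w ++ f ++ w` of length at most `N` are geodesic. -/
def HasContinuations (S : Set G) (N K D : ℕ) : Prop :=
  ∀ w, IsWordIn S w → (SimpleGraph.mulCayley S).dist 1 w.prod = w.length → K ≤ w.length →
    ∃ f, IsWordIn S f ∧ f.length ≤ D ∧ ∀ v, v <:+: w ++ f ++ w → v.length ≤ N →
      (SimpleGraph.mulCayley S).dist 1 v.prod = v.length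

theorem exists_hasContinuations (hfin : S.Finite) {k : ℝ} (hk : 0 ≤ k)
    (hconcat : ConcatenationHypothesis (localGeodesics S hS k)) :
    ∃ D, HasContinuations S ⌊k⌋₊ ⌊k⌋₊ D := by
  have hΓ := isCayleyLike hS hfin
  set K := ⌊k⌋₊ with hK
  unfold ConcatenationHypothesis at hconcat
  -- Fixing the connecting word as a function of the pair makes it range over a finite set when both
  -- words have length `K`.
  choose! F hF hF' using hconcat
  have hA := finite_isWordIn hfin K
  obtain ⟨D, hD⟩ := ((hA.prod hA).image fun q => (F q.1 q.2).length).bddAbove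
  refine ⟨D, fun w hw hgeo hKw => ?_⟩
  have mem : ∀ u, u <:+: w → u ∈ localGeodesics S hS k := fun u hu =>
    ⟨hw.of_infix hu, fun v hv _ =>
      isGeodesicWord_iff.2 (hw.geodesic_of_infix hΓ hgeo (hv.trans hu))⟩
  have h₁ : w.drop (w.length - K) <:+: w := (List.drop_suffix _ _).isInfix
  have h₂ : w.take K <:+: w := (List.take_prefix _ _).isInfix
  refine ⟨F (w.drop (w.length - K)) (w.take K), (hF _ (mem _ h₁) _ (mem _ h₂)).1, ?_, ?_⟩
  · refine hD ⟨(w.drop (w.length - K), w.take K), ⟨⟨hw.of_infix h₁, ?_⟩, hw.of_infix h₂, ?_⟩, rfl⟩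
    · rw [List.length_drop]
      omega
    · rw [List.length_take]
      omega
  · intro v hv hvK
    rcases infix_or_infix_of_length_le hKw hv hvK with h | h
    · exact hw.geodesic_of_infix hΓ hgeo h
    · exact isGeodesicWord_iff.1 ((hF' _ (mem _ h₁) _ (mem _ h₂)).2 v h
        ((Nat.le_floor_iff hk).1 hvK))

end Words

/-! ### Small `δ`: graphs without triangles and reduced words -/

section Tree

namespace Realization

variable {V : Type*} {Γ : SimpleGraph V} {hΓ : Γ.Connected}

/-- An edge is a geodesic segment. -/
theorem exists_edge_segment {u v : V} (h : Γ.Adj u v) :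
    ∃ σ, IsGeodesicSegment (vertex u : Realization Γ hΓ) (vertex v) σ ∧
      (∀ q ∈ σ, ∃ t : ℝ, q.coord = edgeCoord u v t) ∧
      ∃ q ∈ σ, q.coord = edgeCoord u v (1 / 2) := by
  have hp : IsGeod Γ (fun i : ℤ => if i ≤ 0 then u else v) 0 1 := by
    refine isGeod_of_step hΓ (fun i h₁ h₂ => ?_) ?_
    · obtain rfl : i = 0 := by omega
      simpa using (SimpleGraph.dist_eq_one_iff_adj.2 h).le
    · simpa using (SimpleGraph.dist_eq_one_iff_adj.2 h).ge
  have hc : ∀ t : ℝ, 0 ≤ t → t ≤ 1 →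
      (path (hΓ := hΓ) _ hp.clamp_step t).coord = edgeCoord u v t := by
    intro t h₁ h₂
    have := path_coord_of_mem (hΓ := hΓ) hp.clamp_step (i := 0) (t := t) (by simpa using h₁)
      (by simpa using h₂)
    simpa [clamp] using this
  refine ⟨hp.segment, by simpa using hp.isGeodesicSegment (hΓ := hΓ) zero_le_one, ?_, ?_⟩
  · rintro q ⟨t, ht, rfl⟩
    exact ⟨t, hc t (by simpa using ht.1) (by simpa using ht.2)⟩
  · exact ⟨_, ⟨1 / 2, by norm_num, rfl⟩, hc _ (by norm_num) (by norm_num)⟩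

/-- The midpoint of `uv` has coordinate `1/2` at `u`, which vanishes on `vw`, and `1/2` at `v`,
which vanishes on `wu`; coordinates are `1`-Lipschitz, so it is at least `1/2` away from both other
sides. -/
theorem not_adj_of_isHyperbolic {δ : ℝ} (hδ : IsHyperbolic (Realization Γ hΓ) δ)
    (hlt : δ < 1 / 2) {u v w : V} (huv : Γ.Adj u v) (hvw : Γ.Adj v w) : ¬ Γ.Adj w u := by
  intro hwu
  obtain ⟨a, ha, -, p, hpa, hp⟩ := exists_edge_segment (hΓ := hΓ) huv
  obtain ⟨b, hb, hb', -⟩ := exists_edge_segment (hΓ := hΓ) hvw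
  obtain ⟨c, hc, hc', -⟩ := exists_edge_segment (hΓ := hΓ) hwu
  obtain ⟨q, hq | hq, hpq⟩ := hδ.2 _ _ _ _ _ _ ha hb hc p hpa
  · obtain ⟨t, ht⟩ := hb' q hq
    have := abs_coord_sub_le p q u
    rw [hp, ht] at this
    simp only [edgeCoord, if_true, if_neg huv.ne, if_neg hwu.ne'] at this
    norm_num at this
    linarith
  · obtain ⟨t, ht⟩ := hc' q hq
    have := abs_coord_sub_le p q v
    rw [hp, ht] at this
    simp only [edgeCoord, if_true, if_neg huv.ne', if_neg hvw.ne] at this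
    norm_num at this
    linarith

end Realization

variable {G : Type*} [Group G] {S : Set G} {hS : Subgroup.closure S = ⊤} {δ : ℝ}

/-- In a graph without triangles, the reduced words of length at most `2` are geodesic. -/
theorem dist_prod_of_isChain (hΓ : IsCayleyLike (SimpleGraph.mulCayley S))
    (hδ : IsHyperbolic (CayleySpace S hS) δ) (hlt : δ < 1 / 2) {v : List G}
    (hv : IsWordIn S v) (hne : ∀ a ∈ v, a ≠ 1) (hchain : v.IsChain (fun a b => a * b ≠ 1))
    (hlen : v.length ≤ 2) : (SimpleGraph.mulCayley S).dist 1 v.prod = v.length := by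
  have hadj : ∀ (u a : G), a ∈ v → (SimpleGraph.mulCayley S).Adj u (u * a) := by
    intro u a ha
    rw [SimpleGraph.mulCayley_adj]
    exact ⟨fun h => hne a ha (by simpa using h.symm), by simpa using hv a ha⟩
  match v, hv, hne, hchain, hlen, hadj with
  | [], _, _, _, _, _ => simp
  | [a], _, _, _, _, hadj =>
    have := hadj 1 a (by simp)
    rw [one_mul] at this
    simpa using this
  | [a, b], hv, _, hchain, _, hadj =>
    have h₁ := hadj 1 a (by simp)
    have h₂ := hadj a b (by simp)
    rw [one_mul] at h₁
    have h₃ := not_adj_of_isHyperbolic hδ hlt h₁ h₂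
    have h₄ : a * b ≠ 1 := by simpa using hchain
    have h₅ := hv.dist_prod_le hΓ
    have h₆ := hΓ.connected.one_lt_dist_of_ne_of_not_adj h₄.symm fun h => h₃ h.symm
    simp only [List.prod_cons, List.prod_nil, mul_one, List.length_cons, List.length_nil] at *
    omega

theorem ne_one_of_geodesic (hΓ : IsCayleyLike (SimpleGraph.mulCayley S)) {w : List G}
    (hw : IsWordIn S w) (hgeo : (SimpleGraph.mulCayley S).dist 1 w.prod = w.length) :
    ∀ a ∈ w, a ≠ 1 := by
  rintro a ha rfl
  have := hw.geodesic_of_infix hΓ hgeo (v := [1]) (List.singleton_infix_iff _ _ |>.2 ha)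
  simp at this

theorem isChain_of_geodesic (hΓ : IsCayleyLike (SimpleGraph.mulCayley S)) {w : List G}
    (hw : IsWordIn S w) (hgeo : (SimpleGraph.mulCayley S).dist 1 w.prod = w.length) :
    w.IsChain (fun a b => a * b ≠ 1) := by
  rw [List.isChain_iff_forall_rel_of_append_cons_cons]
  intro a b l₁ l₂ h hab
  have := hw.geodesic_of_infix hΓ hgeo (v := [a, b]) ⟨l₁, l₂, by simp [h]⟩
  simp [hab] at this

theorem eq_of_isChain {s : G} {w : List G} (hchain : (s :: w).IsChain (fun a b => a * b ≠ 1))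
    (h : ∀ a ∈ w, a = s ∨ a = s⁻¹) : ∀ a ∈ w, a = s := by
  induction w with
  | nil => simp
  | cons b w ih =>
    rw [List.isChain_cons_cons] at hchain
    have hb : b = s := by
      rcases h b (by simp) with rfl | rfl
      · rfl
      · simp at hchain
    rw [hb] at hchain
    intro a ha
    rcases List.mem_cons.1 ha with rfl | ha
    · exact hb
    · exact ih hchain.2 (fun a ha => h a (by simp [ha])) a ha

/-- It is enough that `w ++ f ++ w` is reduced. The empty `f` works unless the last letter of `w`
cancels the first letter `s`; then a letter other than `s` and `s⁻¹` is inserted. -/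
theorem hasContinuations_of_lt_half (hfin : S.Finite) (hδ : IsHyperbolic (CayleySpace S hS) δ)
    (hlt : δ < 1 / 2) : HasContinuations S 2 2 1 := by
  have hΓ := isCayleyLike hS hfin
  intro w hw hgeo hlen
  have hne := ne_one_of_geodesic hΓ hw hgeo
  have hchain := isChain_of_geodesic hΓ hw hgeo
  suffices h : ∃ f : List G, IsWordIn S f ∧ f.length ≤ 1 ∧ (∀ a ∈ f, a ≠ 1) ∧
      (w ++ f ++ w).IsChain (fun a b => a * b ≠ 1) by
    obtain ⟨f, h₁, h₂, h₃, h₄⟩ := h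
    refine ⟨f, h₁, h₂, fun v hv hvl => ?_⟩
    have hmem : ∀ a ∈ v, a ∈ w ∨ a ∈ f := by
      intro a ha
      have := hv.subset ha
      simp only [List.mem_append] at this
      tauto
    exact dist_prod_of_isChain hΓ hδ hlt (fun a ha => (hmem a ha).elim (hw a) (h₁ a))
      (fun a ha => (hmem a ha).elim (hne a) (h₃ a)) (h₄.infix hv) hvl
  obtain ⟨s, w', rfl⟩ := List.exists_cons_of_length_pos (by omega : 0 < w.length)
  set w := s :: w' with hw'
  have hw₀ : w ≠ [] := by simp [hw']
  set u := w.getLast hw₀ with hu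
  have hlast : w.getLast? = some u := List.getLast?_eq_some_getLast hw₀
  by_cases hus : u * s = 1
  · have hs : u⁻¹ = s := inv_eq_of_mul_eq_one_right hus
    -- Otherwise the reduced word `w` is a power of `s`, its last letter is `s`, and the
    -- cancellation says `s * s = 1`; this contradicts reducedness as `w` has at least two letters.
    obtain ⟨t, ht, ht₁, hts, hts'⟩ : ∃ t, (t ∈ S ∨ t⁻¹ ∈ S) ∧ t ≠ 1 ∧ t ≠ s ∧ t ≠ s⁻¹ := by
      by_contra! hcon
      have hall : ∀ a ∈ w', a = s := eq_of_isChain hchain fun a ha => by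
        by_cases has : a = s
        · exact Or.inl has
        · exact Or.inr (hcon a (hw a (by simp [hw', ha])) (hne a (by simp [hw', ha])) has)
      have hu' : u = s := by
        rcases List.mem_cons.1 (List.getLast_mem hw₀) with h | h
        · exact h
        · exact hall _ h
      obtain ⟨b, l, rfl⟩ : ∃ b l, w' = b :: l :=
        List.exists_cons_of_length_pos (by rw [hw', List.length_cons] at hlen; omega)
      rw [hw', List.isChain_cons_cons, hall b (by simp)] at hchain
      exact hchain.1 (by rw [← hus, hu'])
    refine ⟨[t], by simpa [IsWordIn] using ht, le_rfl, by simpa using ht₁, ?_⟩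
    rw [List.isChain_append, List.isChain_append]
    refine ⟨⟨hchain, by simp, ?_⟩, hchain, ?_⟩
    · intro x hx y hy h
      rw [hlast, Option.mem_some_iff] at hx
      subst hx
      obtain rfl : t = y := by simpa using hy
      exact hts (by rw [← hs, inv_eq_of_mul_eq_one_right h])
    · intro x hx y hy h
      obtain rfl : t = x := by simpa using hx
      obtain rfl : s = y := by simpa [hw'] using hy
      exact hts' (eq_inv_of_mul_eq_one_left h)
  · refine ⟨[], by simp [IsWordIn], by simp, by simp, ?_⟩
    rw [List.append_nil, List.isChain_append]
    refine ⟨hchain, hchain, ?_⟩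
    intro x hx y hy
    rw [hlast, Option.mem_some_iff] at hx
    subst hx
    obtain rfl : s = y := by simpa [hw'] using hy
    exact hus

end Tree

/-! ### Assembling the constants -/

section Main

variable {G : Type*} [Group G] {S : Set G} {hS : Subgroup.closure S = ⊤} {δ : ℝ}

theorem HasContinuations.exists_isPeriodicGeod {N K D : ℕ} (hS : Subgroup.closure S = ⊤)
    (hfin : S.Finite) (h : HasContinuations S N K D)
    (hN : 0 < N) (hNK : N ≤ K) (g : G) (hg : K ≤ (SimpleGraph.mulCayley S).dist 1 g) :
    ∃ g' c ℓ, (SimpleGraph.mulCayley S).dist g g' ≤ D ∧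
      IsPeriodicGeod (SimpleGraph.mulCayley S) N g' c ℓ := by
  have hΓ := isCayleyLike hS hfin
  obtain ⟨w, hw, rfl, hgeo⟩ := exists_geodesic_word hS g
  obtain ⟨f, h₁, h₂, h₃⟩ := h w hw hgeo (by omega)
  refine ⟨_, _, _, ?_, isPeriodicGeod_wordLine hΓ hN (by omega) h₃⟩
  have := hΓ.dist_mul w.prod 1 f.prod
  rw [mul_one] at this
  rw [List.prod_append, this]
  exact (h₁.dist_prod_le hΓ).trans h₂

theorem HasContinuations.mono {N N' K D : ℕ} (h : HasContinuations S N K D) (hN : N' ≤ N) :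
    HasContinuations S N' K D := by
  intro w hw hgeo hK
  obtain ⟨f, h₁, h₂, h₃⟩ := h w hw hgeo hK
  exact ⟨f, h₁, h₂, fun v hv hvN => h₃ v hv (hvN.trans hN)⟩

theorem exists_hasContinuations_of_isHyperbolic (hfin : S.Finite)
    (hδ : IsHyperbolic (CayleySpace S hS) δ)
    (hconcat : ConcatenationHypothesis (localGeodesics S hS (10 * δ))) :
    ∃ K D, 8 * ⌊δ⌋₊ + 2 ≤ K ∧ HasContinuations S (8 * ⌊δ⌋₊ + 2) K D := by
  -- For `10δ < 2` the language constrains single letters at most, too little to exclude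
  -- backtracking.
  rcases lt_or_ge δ (1 / 5) with h | h
  · have h₀ : ⌊δ⌋₊ = 0 := Nat.floor_eq_zero.2 (by linarith)
    rw [h₀]
    exact ⟨2, 1, le_rfl, hasContinuations_of_lt_half hfin hδ (by linarith)⟩
  · obtain ⟨D, hD⟩ := exists_hasContinuations hfin (by linarith : 0 ≤ 10 * δ) hconcat
    -- If `⌊δ⌋₊ = 0` this is `2 ≤ 10δ`; otherwise `2 ≤ 2⌊δ⌋₊`.
    have hle : 8 * ⌊δ⌋₊ + 2 ≤ ⌊10 * δ⌋₊ := by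
      refine Nat.le_floor ?_
      push_cast
      have h₁ := Nat.floor_le (by linarith : 0 ≤ δ)
      rcases Nat.eq_zero_or_pos ⌊δ⌋₊ with h₂ | h₂
      · rw [h₂]
        push_cast
        linarith
      · have : (1 : ℝ) ≤ ⌊δ⌋₊ := mod_cast h₂
        linarith
    exact ⟨_, D, hle, hD.mono hle⟩

/-- Every element is close to an element that shifts a periodic local geodesic. -/
theorem exists_dist_le_isPeriodicGeod [Infinite G] (hfin : S.Finite)
    (hδ : IsHyperbolic (CayleySpace S hS) δ)
    (hconcat : ConcatenationHypothesis (localGeodesics S hS (10 * δ))) :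
    ∃ D : ℕ, ∀ g : G, ∃ g' c ℓ, (SimpleGraph.mulCayley S).dist g g' ≤ D ∧
      IsPeriodicGeod (SimpleGraph.mulCayley S) (8 * ⌊δ⌋₊ + 2) g' c ℓ := by
  have hΓ := isCayleyLike hS hfin
  obtain ⟨K, D, hK, hD⟩ := exists_hasContinuations_of_isHyperbolic hfin hδ hconcat
  obtain ⟨h, hh⟩ := (hΓ.finite_ball K).exists_notMem
  have hh' : K ≤ (SimpleGraph.mulCayley S).dist 1 h := (not_le.1 hh).le
  -- Elements that are too short are replaced by the fixed element `h`.
  refine ⟨K + (SimpleGraph.mulCayley S).dist 1 h + D, fun g => ?_⟩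
  rcases Nat.lt_or_ge ((SimpleGraph.mulCayley S).dist 1 g) K with hg | hg
  · obtain ⟨g', c, ℓ, h₁, h₂⟩ :=
      hD.exists_isPeriodicGeod hS hfin (by omega) hK h hh'
    refine ⟨g', c, ℓ, ?_, h₂⟩
    have t₁ : (SimpleGraph.mulCayley S).dist g g' ≤ (SimpleGraph.mulCayley S).dist g 1 +
      (SimpleGraph.mulCayley S).dist 1 g' := hΓ.connected.dist_triangle
    have t₂ : (SimpleGraph.mulCayley S).dist 1 g' ≤ (SimpleGraph.mulCayley S).dist 1 h +
      (SimpleGraph.mulCayley S).dist h g' := hΓ.connected.dist_triangle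
    rw [SimpleGraph.dist_comm (u := g) (v := 1)] at t₁
    omega
  · obtain ⟨g', c, ℓ, h₁, h₂⟩ :=
      hD.exists_isPeriodicGeod hS hfin (by omega) hK g hg
    exact ⟨g', c, ℓ, by omega, h₂⟩

end Main

end CayleyHyp

end

theorem mainTheorem5 {G : Type*} [Group G] [Infinite G] (S : Set G) (hfin : S.Finite)
    (hS : Subgroup.closure S = ⊤) (δ : ℝ)
    (hδ : CayleyHyp.IsHyperbolic (CayleyHyp.CayleySpace S hS) δ)
    (hconcat : CayleyHyp.ConcatenationHypothesis (CayleyHyp.localGeodesics S hS (10 * δ))) :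
    ∃ D R : ℝ, ∀ g : G,
      10 * δ ≤ dist (CayleyHyp.cayleyVertex S hS 1) (CayleyHyp.cayleyVertex S hS g) →
      ∃ g' : G, dist (CayleyHyp.cayleyVertex S hS g) (CayleyHyp.cayleyVertex S hS g') ≤ D ∧
        CayleyHyp.ActsLoxodromically (CayleyHyp.cayleyVertex S hS 1) g' ∧
        ¬ IsOfFinOrder g' ∧
        (∃ γ : ℝ → CayleyHyp.CayleySpace S hS,
          CayleyHyp.IsAxis (CayleyHyp.cayleyVertex S hS 1) g' γ) ∧
        ∀ γ : ℝ → CayleyHyp.CayleySpace S hS,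
          CayleyHyp.IsAxis (CayleyHyp.cayleyVertex S hS 1) g' γ →
            ∃ t : ℝ, dist (CayleyHyp.cayleyVertex S hS 1) (γ t) ≤ R := by
  obtain ⟨D, hD⟩ := CayleyHyp.exists_dist_le_isPeriodicGeod hfin hδ hconcat
  refine ⟨D, 2 * ⌊δ⌋₊ + 2 * δ, fun g _ => ?_⟩
  obtain ⟨g', c, ℓ, h₁, h₂⟩ := hD g
  refine ⟨g', ?_, h₂.actsLoxodromically hfin hδ,
    h₂.not_isOfFinOrder (CayleyHyp.isCayleyLike hS hfin)
      (CayleyHyp.Realization.vertexHyperbolic (hΓ := CayleyHyp.cayley_connected hS) hδ),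
    h₂.exists_isAxis hfin hδ, fun γ hγ => h₂.exists_dist_axis_le hfin hδ hγ⟩
  rw [CayleyHyp.cayleyVertex, CayleyHyp.cayleyVertex, CayleyHyp.Realization.dist_vertex]
  exact mod_cast h₁
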